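/- Corollary 3 (MISO networks with coordinated beamforming). Let $L:[0,\infty)\to[0,\infty)$ be a physically feasible path loss function, that is, $L(r)\le L_0:=L(0)<\infty$ for all $r\ge 0$ and $\gamma:=\int_0^\infty rL(r)\,dr\in(0,\infty)$, and let $L$ be continuous at $0$. For each $\lambda>0$ the base stations (BSs) form a homogeneous Poisson point process $\Phi=\Phi_\lambda$ of intensity $\lambda$ in the plane, with distances $r_0\le r_1\le r_2\le\cdots$ to the tagged user at the origin. Each BS has $N_t(\lambda)\in\mathbb N$ antennas, where $N_t$ is non-decreasing and $N_t(\lambda)\to\infty$ as $\lambda\to\infty$. The user is served by the closest BS, and the interference of the $N_t(\lambda)-1$ closest interferers is perfectly cancelled by coordinated beamforming, so that the conditional SINR and the conditional area spectral efficiency (ASE) are $$\mathrm{SINR}(\lambda)=\frac{L(r_0)\,\tilde g}{\sum_{i\ge N_t(\lambda)}L(r_i)g_i+\sigma^2},\qquad \mathcal E(\lambda)=\lambda\log_2\bigl(1+\mathrm{SINR}(\lambda)\bigr),$$ where $\sigma^2\ge 0$ is the noise power, the fading gains $g_i$ are i.i.d. exponential with unit mean, and $\tilde g$ is independent of them and Gamma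 distributed with shape $N_t(\lambda)$ and unit rate; all gains are independent of the BS positions. The networks are realized for all $\lambda$ on one probability space by superposition: the points of $\Phi_b\setminus\Phi_a$, $a<b$, form a Poisson process of intensity $b-a$ independent of $\Phi_a$ (that is, $\Phi_\lambda$ consists of the first coordinates of the points $(x,t)$ with $t\le\lambda$ of a unit-intensity Poisson process on $\mathbb R^2\times(0,\infty)$), each BS keeps its gain, and $\tilde g=\sum_{n=1}^{N_t(\lambda)}f_n$ with one sequence $f_1,f_2,\dots$ of i.i.d. unit-mean exponential variables. Then almost surely the interference sum converges for all $\lambda>0$, and the following hold. 1. If $\lim_{\lambda\to\infty}\lambda/N_t(\lambda)=\infty$, then almost surely $$\lim_{\lambda\to\infty}\frac{\lambda}{N_t(\lambda)}\,\mathrm{SINR}(\lambda)=\frac{L_0}{2\pi\gamma},$$ and $\mathcal E(\lambda)\to\infty$ at scale $N_t(\lambda)$, which is also the scale $\lambda\log_2(1+N_t(\lambda)/\lambda)$: $$\lim_{\lambda\to\infty}\frac{\mathcal E(\lambda)}{N_t(\lambda)}=\frac{L_0}{2\pi\gamma\ln 2},\qquad \lim_{\lambda\to\infty}\frac{\mathcal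 E(\lambda)}{\lambda\log_2(1+N_t(\lambda)/\lambda)}=\frac{L_0}{2\pi\gamma}.$$ 2. If $\lim_{\lambda\to\infty}\lambda/N_t(\lambda)=c>\frac{L_0}{2\pi\gamma}$, then there is a constant $\ell$ with $$\frac{L_0}{2\pi c\gamma}\le \ell\le\frac{L_0}{2\pi c\gamma-L_0}$$ such that almost surely $\lim_{\lambda\to\infty}\mathrm{SINR}(\lambda)=\ell$, and $\mathcal E(\lambda)\to\infty$ at scale $\lambda$, which is also the scale $\lambda\log_2(1+N_t(\lambda)/\lambda)$: $$\lim_{\lambda\to\infty}\frac{\mathcal E(\lambda)}{\lambda}=\log_2(1+\ell),\qquad \lim_{\lambda\to\infty}\frac{\mathcal E(\lambda)}{\lambda\log_2(1+N_t(\lambda)/\lambda)}=\frac{\log_2(1+\ell)}{\log_2(1+1/c)}.$$ -/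

import Mathlib

open MeasureTheory ProbabilityTheory Filter Topology Set

/-- The Euclidean plane, in which the base stations (BSs) live; the tagged user is at `0`. -/
abbrev Plane : Type := EuclideanSpace ℝ (Fin 2)

/-- The constant `γ = ∫₀^∞ r L(r) dr`. -/
noncomputable def pathLossGamma (L : ℝ → ℝ) : ℝ := ∫ r in Ioi (0 : ℝ), r * L r

/-- Physically feasible path loss: a function `L` on `[0, ∞)` (values at negative arguments are
irrelevant) with values in `[0, L(0)]` and with `γ = ∫₀^∞ r L(r) dr` finite and positive. -/
structure PhysicallyFeasible (L : ℝ → ℝ) : Prop where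
  nonneg : ∀ r, 0 ≤ r → 0 ≤ L r
  le_zero : ∀ r, 0 ≤ r → L r ≤ L 0
  integrable : IntegrableOn (fun r => r * L r) (Ioi 0)
  gamma_pos : 0 < pathLossGamma L

/-- `count B ω` is the number of points that a random collection of points of `E` has in `B`.
The collection is a Poisson point process with intensity measure `ν` if the number of points in a
measurable set `B` with `ν B < ∞` is Poisson distributed with mean `ν B`, and the numbers of points
in finitely many pairwise disjoint measurable sets are independent. -/
structure IsPoissonProcess {Ω E : Type*} [MeasurableSpace Ω] [MeasurableSpace E]
    (count : Set E → Ω → ℕ∞) (ν : Measure E) (P : Measure Ω) : Prop where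
  law : ∀ B : Set E, MeasurableSet B → ν B ≠ ⊤ →
    HasLaw (count B) ((poissonMeasure (ν B).toNNReal).map (Nat.cast : ℕ → ℕ∞)) P
  indep : ∀ (n : ℕ) (B : Fin n → Set E), (∀ j, MeasurableSet (B j)) →
    Pairwise (fun j k => Disjoint (B j) (B k)) → iIndepFun (fun j => count (B j)) P

/-- The network model, jointly for all BS densities, by superposition of Poisson processes.
BS number `i` sits at `X i`, has fading gain `g i` to the tagged user, and is present in the
network of density `ρ` exactly when `T i ≤ ρ`. The points `(X i, T i)` form a Poisson process of
unit intensity on `ℝ² × (0, ∞)`; that is, the BSs that are added when the density grows from `a` to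
`b` form a homogeneous Poisson process of intensity `b - a`, independently of the earlier ones.
`f n` is the gain of the `n`-th transmit antenna in the desired link. All gains are i.i.d.
exponential with unit mean and independent of the BS positions. -/
structure IsDensifyingNetwork {Ω : Type*} [MeasurableSpace Ω] (P : Measure Ω)
    (X : ℕ → Ω → Plane) (T : ℕ → Ω → ℝ) (g f : ℕ → Ω → ℝ) : Prop where
  measurable_X : ∀ i, Measurable (X i)
  measurable_T : ∀ i, Measurable (T i)
  T_pos : ∀ i ω, 0 < T i ω
  poisson : IsPoissonProcess
    (fun (B : Set (Plane × ℝ)) ω => {i : ℕ | (X i ω, T i ω) ∈ B}.encard)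
    ((volume : Measure Plane).prod (volume.restrict (Ioi (0 : ℝ)))) P
  measurable_g : ∀ i, Measurable (g i)
  measurable_f : ∀ n, Measurable (f n)
  law_g : ∀ i, HasLaw (g i) (expMeasure 1) P
  law_f : ∀ n, HasLaw (f n) (expMeasure 1) P
  indep_gains : iIndepFun (Sum.elim g f) P
  indep_positions :
    IndepFun (fun ω i => (X i ω, T i ω)) (fun ω (j : ℕ ⊕ ℕ) => Sum.elim g f j ω) P

/-- At each density `ρ`, the BSs present form a homogeneous Poisson process of intensity `ρ`. -/
theorem IsDensifyingNetwork.poisson_at {Ω : Type*} [MeasurableSpace Ω] {P : Measure Ω}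
    {X : ℕ → Ω → Plane} {T : ℕ → Ω → ℝ} {g f : ℕ → Ω → ℝ}
    (h : IsDensifyingNetwork P X T g f) (ρ : ℝ) :
    IsPoissonProcess (fun (B : Set Plane) ω => {i : ℕ | T i ω ≤ ρ ∧ X i ω ∈ B}.encard)
      (ENNReal.ofReal ρ • (volume : Measure Plane)) P := by
  have hset : ∀ (B : Set Plane) (ω : Ω), {i : ℕ | T i ω ≤ ρ ∧ X i ω ∈ B} =
      {i : ℕ | (X i ω, T i ω) ∈ B ×ˢ Iic ρ} := fun B ω => by
    ext i
    simp [and_comm]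
  have hmeas : ∀ B : Set Plane,
      ((volume : Measure Plane).prod (volume.restrict (Ioi (0 : ℝ)))) (B ×ˢ Iic ρ) =
        (ENNReal.ofReal ρ • (volume : Measure Plane)) B := fun B => by
    rw [Measure.prod_prod, Measure.restrict_apply measurableSet_Iic, Iic_inter_Ioi,
      Real.volume_Ioc, sub_zero, Measure.smul_apply, smul_eq_mul, mul_comm]
  constructor
  · intro B hB hfin
    have := h.poisson.law (B ×ˢ Iic ρ) (hB.prod measurableSet_Iic) (by rwa [hmeas])
    rw [hmeas] at this
    simpa only [hset] using this
  · intro n B hB hd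
    have := h.poisson.indep n (fun j => B j ×ˢ Iic ρ) (fun j => (hB j).prod measurableSet_Iic)
      (fun j k hjk => Disjoint.set_prod_left (hd hjk) _ _)
    simpa only [hset] using this

section SINR

variable {Ω : Type*} (X : ℕ → Ω → Plane) (T : ℕ → Ω → ℝ) (g f : ℕ → Ω → ℝ) (L : ℝ → ℝ)
  (σ : ℝ) (N : ℝ → ℕ)

/-- `r_n`: the distances from the user to the BSs present at density `ρ`, in increasing order, are
`r_0 ≤ r_1 ≤ ⋯`; so `r_n` is the least radius `r` such that more than `n` of these BSs are at
distance at most `r`. The serving BS is the one at distance `r_0`. -/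
noncomputable def orderedDist (ρ : ℝ) (n : ℕ) (ω : Ω) : ℝ :=
  sInf {r : ℝ | 0 ≤ r ∧ (n : ℕ∞) < {i : ℕ | T i ω ≤ ρ ∧ ‖X i ω‖ ≤ r}.encard}

/-- The power received from BS `i` at density `ρ`, as far as it is residual interference: the
serving BS and the `N(ρ) - 1` closest interferers (at the distances `r_0, …, r_{N(ρ)-1}`) do not
contribute, the BSs at distance at least `r_{N(ρ)}` do. -/
noncomputable def residualTerm (ρ : ℝ) (ω : Ω) (i : ℕ) : ℝ :=
  indicator {i : ℕ | T i ω ≤ ρ ∧ orderedDist X T ρ (N ρ) ω ≤ ‖X i ω‖}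
    (fun i => L ‖X i ω‖ * g i ω) i

/-- The conditional SINR with coordinated beamforming,
`L(r_0) g̃ / (∑_{r_i ∈ Φ \ B(0, r_N)} L(r_i) g_i + σ²)`, where `g̃ = f_0 + ⋯ + f_{N-1}` is
Gamma distributed with shape `N = N(ρ)` and unit rate. -/
noncomputable def condSINR (ρ : ℝ) (ω : Ω) : ℝ :=
  L (orderedDist X T ρ 0 ω) * (∑ n ∈ Finset.range (N ρ), f n ω) /
    (∑' i, residualTerm X T g L N ρ ω i + σ ^ 2)

/-- The conditional area spectral efficiency `ρ log₂(1 + SINR(ρ))`. -/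
noncomputable def condASE (ρ : ℝ) (ω : Ω) : ℝ :=
  ρ * Real.logb 2 (1 + condSINR X T g f L σ N ρ ω)

end SINR

open scoped ENNReal NNReal

/-! Everything reduces to a strong law for sums over the stations present at density `ρ`. For a
nonnegative function `φ` on the plane with finite first and second moments, and unit-mean marks
independent of the positions, the marked sum `S ρ` of `φ` has mean `ρ ∫ φ`, and its variance is at
most `2 ρ ∫ φ²`. Hence `S ρ / ρ` has variance `O(1/ρ)`, which is summable along the squares `ρ =
n²`; since superposition makes `S` monotone in `ρ`, almost sure convergence along squares extends to
all `ρ` (`ae_tendsto_densitySum_div`).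

Two choices of `φ` matter. Indicators of discs show that a disc of radius `q` holds about `π q² ρ`
stations, so if `N ρ / ρ → π a²`, then the distance of index `N ρ` tends to `a`
(`tendsto_orderedDist`). The path loss outside a disc, with the fading gains as marks, shows that
the interference from beyond radius `q` is about `ρ F(q)`, where `F(q) = ∫_{|x| ≥ q} L(|x|) dx` is
`farField`. Both hold almost surely for all rational radii at once; monotonicity in the radius and
continuity of `F` then allow the random, `ρ`-dependent radius (`tendsto_residual_div`).

The serving distance tends to `0`, so the serving path loss tends to `L 0`, and the desired gain
divided by `N ρ` tends to `1`. Together, `(ρ / N) SINR → L 0 / F(a)`. In the first regime `a = 0`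
and `F(0) = 2πγ`. In the second `π a² = 1/c`, and `2πγ - L 0 / c ≤ F(a) ≤ 2πγ` gives the bounds on
the limit. -/

/-! ### Moments of the Poisson distribution -/

/-- The factor `n` cancels in `rⁿ / n!`, which shifts the index by one. Applied to `1` and to `n`,
this gives the first two moments. -/
theorem lintegral_poissonMeasure_natCast_mul (r : ℝ≥0) (φ : ℕ → ℝ≥0∞) :
    ∫⁻ n, (n : ℝ≥0∞) * φ n ∂(poissonMeasure r) = r * ∫⁻ n, φ (n + 1) ∂(poissonMeasure r) := by
  have key : ∀ ψ : ℕ → ℝ≥0∞, ∫⁻ n, ψ n ∂(poissonMeasure r) =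
      ∑' n : ℕ, ENNReal.ofReal (Real.exp (-r) * r ^ n / n.factorial) * ψ n := fun ψ => by
    rw [poissonMeasure, lintegral_sum_measure]
    simp [lintegral_smul_measure]
  rw [key, key, tsum_eq_zero_add' ENNReal.summable, ← ENNReal.tsum_mul_left]
  simp only [Nat.cast_zero, zero_mul, mul_zero, zero_add]
  refine tsum_congr fun n => ?_
  have h1 : ((n + 1 : ℕ) : ℝ≥0∞) = ENNReal.ofReal (n + 1 : ℝ) := by
    rw [← ENNReal.ofReal_natCast]; push_cast; rfl
  have h2 : (r : ℝ≥0∞) = ENNReal.ofReal (r : ℝ) := by simp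
  rw [h1, h2, ← mul_assoc, ← mul_assoc, ← ENNReal.ofReal_mul (by positivity),
    ← ENNReal.ofReal_mul (by positivity)]
  congr 2
  rw [Nat.factorial_succ]
  push_cast
  field_simp
  ring

theorem lintegral_poissonMeasure_natCast (r : ℝ≥0) :
    ∫⁻ n, (n : ℝ≥0∞) ∂(poissonMeasure r) = r := by
  simpa using lintegral_poissonMeasure_natCast_mul r (fun _ => 1)

theorem lintegral_poissonMeasure_natCast_mul_self (r : ℝ≥0) :
    ∫⁻ n, (n : ℝ≥0∞) * n ∂(poissonMeasure r) = r * (r + 1) := by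
  rw [lintegral_poissonMeasure_natCast_mul r (fun n => (n : ℝ≥0∞))]
  simp only [Nat.cast_add, Nat.cast_one]
  rw [lintegral_add_right _ measurable_const, lintegral_poissonMeasure_natCast]
  simp

/-! ### First and second moment measures of a Poisson process -/

section PointCount

variable {Ω E : Type*}

/-- The number of the points `Z i ω` in `B`, as an extended nonnegative real. -/
noncomputable def pointCount (Z : ℕ → Ω → E) (B : Set E) (ω : Ω) : ℝ≥0∞ :=
  ∑' i, B.indicator 1 (Z i ω)

theorem pointCount_eq_encard (Z : ℕ → Ω → E) (B : Set E) (ω : Ω) :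
    pointCount Z B ω = ({i : ℕ | Z i ω ∈ B}.encard : ℝ≥0∞) := by
  rw [← Measure.count_apply (MeasurableSet.of_discrete), Measure.count, Measure.sum_apply _ (MeasurableSet.of_discrete)]
  refine tsum_congr fun i => ?_
  rw [Measure.dirac_apply' _ MeasurableSet.of_discrete]
  rfl

theorem pointCount_union (Z : ℕ → Ω → E) {A B : Set E} (h : Disjoint A B) (ω : Ω) :
    pointCount Z (A ∪ B) ω = pointCount Z A ω + pointCount Z B ω := by
  simp only [pointCount]
  rw [← ENNReal.tsum_add]
  refine tsum_congr fun i => ?_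
  rw [indicator_union_of_disjoint h]

variable [MeasurableSpace Ω] [MeasurableSpace E]

theorem measurable_pointCount {Z : ℕ → Ω → E} (hZ : ∀ i, Measurable (Z i)) {B : Set E}
    (hB : MeasurableSet B) : Measurable (pointCount Z B) :=
  Measurable.tsum fun i => (measurable_one.indicator hB).comp (hZ i)

variable {Z : ℕ → Ω → E} {ν : Measure E} {P : Measure Ω}

theorem IsPoissonProcess.lintegral_comp_pointCount
    (h : IsPoissonProcess (fun B ω => {i : ℕ | Z i ω ∈ B}.encard) ν P) {B : Set E}
    (hB : MeasurableSet B) (hfin : ν B ≠ ⊤) (φ : ℝ≥0∞ → ℝ≥0∞) :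
    ∫⁻ ω, φ (pointCount Z B ω) ∂P = ∫⁻ n, φ (n : ℝ≥0∞) ∂(poissonMeasure (ν B).toNNReal) := by
  simp_rw [pointCount_eq_encard]
  rw [(h.law B hB hfin).lintegral_comp (f := fun n : ℕ∞ => φ (n : ℝ≥0∞))
    (Measurable.of_discrete.aemeasurable), lintegral_map Measurable.of_discrete
    Measurable.of_discrete]
  simp

theorem IsPoissonProcess.lintegral_pointCount
    (h : IsPoissonProcess (fun B ω => {i : ℕ | Z i ω ∈ B}.encard) ν P) {B : Set E}
    (hB : MeasurableSet B) (hfin : ν B ≠ ⊤) :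
    ∫⁻ ω, pointCount Z B ω ∂P = ν B := by
  rw [h.lintegral_comp_pointCount hB hfin (fun x => x), lintegral_poissonMeasure_natCast,
    ENNReal.coe_toNNReal hfin]

theorem IsPoissonProcess.lintegral_pointCount_mul_self
    (h : IsPoissonProcess (fun B ω => {i : ℕ | Z i ω ∈ B}.encard) ν P) {B : Set E}
    (hB : MeasurableSet B) (hfin : ν B ≠ ⊤) :
    ∫⁻ ω, pointCount Z B ω * pointCount Z B ω ∂P = ν B * (ν B + 1) := by
  rw [h.lintegral_comp_pointCount hB hfin (fun x => x * x),
    lintegral_poissonMeasure_natCast_mul_self, ENNReal.coe_toNNReal hfin]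

theorem IsPoissonProcess.lintegral_pointCount_mul_of_disjoint (hZ : ∀ i, Measurable (Z i))
    (h : IsPoissonProcess (fun B ω => {i : ℕ | Z i ω ∈ B}.encard) ν P) {A B : Set E}
    (hA : MeasurableSet A) (hB : MeasurableSet B) (hAfin : ν A ≠ ⊤) (hBfin : ν B ≠ ⊤)
    (hd : Disjoint A B) :
    ∫⁻ ω, pointCount Z A ω * pointCount Z B ω ∂P = ν A * ν B := by
  have hind : IndepFun (pointCount Z A) (pointCount Z B) P := by
    have h0 := h.indep 2 ![A, B] (by simp [Fin.forall_fin_two, hA, hB])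
      (by
        intro j k hjk
        fin_cases j <;> fin_cases k <;> simp_all [disjoint_comm])
    have h1 := h0.indepFun (show (0 : Fin 2) ≠ 1 by decide)
    have h2 := h1.comp (φ := fun n : ℕ∞ => (n : ℝ≥0∞)) (ψ := fun n : ℕ∞ => (n : ℝ≥0∞))
      Measurable.of_discrete Measurable.of_discrete
    convert! h2 using 1 <;> (ext ω; simp [pointCount_eq_encard])
  have := lintegral_mul_eq_lintegral_mul_lintegral_of_indepFun (measurable_pointCount hZ hA)
    (measurable_pointCount hZ hB) hind
  rw [h.lintegral_pointCount hA hAfin, h.lintegral_pointCount hB hBfin] at this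
  exact this

/-- Split both sets along `A ∩ B`. Counts in disjoint pieces are independent, so only the square of
the count in `A ∩ B` produces a term beyond the product of the means: its Poisson variance. -/
theorem IsPoissonProcess.lintegral_pointCount_mul (hZ : ∀ i, Measurable (Z i))
    (h : IsPoissonProcess (fun B ω => {i : ℕ | Z i ω ∈ B}.encard) ν P) {A B : Set E}
    (hA : MeasurableSet A) (hB : MeasurableSet B) (hAfin : ν A ≠ ⊤) (hBfin : ν B ≠ ⊤) :
    ∫⁻ ω, pointCount Z A ω * pointCount Z B ω ∂P = ν A * ν B + ν (A ∩ B) := by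
  have hdA : Disjoint (A ∩ B) (A \ B) := disjoint_sdiff_right.mono_left inter_subset_right
  have hdB : Disjoint (A ∩ B) (B \ A) := disjoint_sdiff_right.mono_left inter_subset_left
  have hdd : Disjoint (A \ B) (B \ A) := disjoint_sdiff_left.mono_right sdiff_subset
  have eA : A = (A ∩ B) ∪ (A \ B) := (inter_union_sdiff A B).symm
  have eB : B = (A ∩ B) ∪ (B \ A) := by rw [inter_comm]; exact (inter_union_sdiff B A).symm
  have mI := hA.inter hB
  have mA := hA.diff hB
  have mB := hB.diff hA
  have fI : ν (A ∩ B) ≠ ⊤ := measure_ne_top_of_subset inter_subset_left hAfin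
  have fA : ν (A \ B) ≠ ⊤ := measure_ne_top_of_subset sdiff_subset hAfin
  have fB : ν (B \ A) ≠ ⊤ := measure_ne_top_of_subset sdiff_subset hBfin
  have vA : ν A = ν (A ∩ B) + ν (A \ B) := (measure_inter_add_sdiff A hB).symm
  have vB : ν B = ν (A ∩ B) + ν (B \ A) := by
    rw [inter_comm]; exact (measure_inter_add_sdiff B hA).symm
  have cA : ∀ ω, pointCount Z A ω = pointCount Z (A ∩ B) ω + pointCount Z (A \ B) ω :=
    fun ω => by rw [← pointCount_union Z hdA, ← eA]
  have cB : ∀ ω, pointCount Z B ω = pointCount Z (A ∩ B) ω + pointCount Z (B \ A) ω :=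
    fun ω => by rw [← pointCount_union Z hdB, ← eB]
  have kI := measurable_pointCount hZ mI
  have kA := measurable_pointCount hZ mA
  have kB := measurable_pointCount hZ mB
  simp_rw [cA, cB, add_mul, mul_add]
  rw [lintegral_add_left (by fun_prop), lintegral_add_left (by fun_prop),
    lintegral_add_left (by fun_prop), h.lintegral_pointCount_mul_self mI fI,
    h.lintegral_pointCount_mul_of_disjoint hZ mI mB fI fB hdB,
    h.lintegral_pointCount_mul_of_disjoint hZ mA mI fA fI hdA.symm,
    h.lintegral_pointCount_mul_of_disjoint hZ mA mB fA fB hdd, vA, vB]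
  ring

/-- The intensity measure of a Poisson process is the sum of the laws of its points. -/
theorem IsPoissonProcess.sum_map_eq [SigmaFinite ν] (hZ : ∀ i, Measurable (Z i))
    (h : IsPoissonProcess (fun B ω => {i : ℕ | Z i ω ∈ B}.encard) ν P) :
    Measure.sum (fun i => P.map (Z i)) = ν := by
  rw [Measure.ext_iff_of_iUnion_eq_univ (iUnion_spanningSets ν)]
  intro k
  ext s hs
  rw [Measure.restrict_apply hs, Measure.restrict_apply hs]
  have hm : MeasurableSet (s ∩ spanningSets ν k) := hs.inter (measurableSet_spanningSets ν k)
  rw [← h.lintegral_pointCount hm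
    (measure_ne_top_of_subset inter_subset_right (measure_spanningSets_lt_top ν k).ne),
    Measure.sum_apply _ hm]
  simp only [pointCount]
  rw [lintegral_tsum (f := fun i ω => (s ∩ spanningSets ν k).indicator 1 (Z i ω))
    fun i => ((measurable_one.indicator hm).comp (hZ i)).aemeasurable]
  refine tsum_congr fun i => ?_
  rw [← lintegral_map (measurable_one.indicator hm) (hZ i), lintegral_indicator_one hm]

/-- The second moment measure of a Poisson process. -/
theorem IsPoissonProcess.sum_map_prod_eq [SigmaFinite ν] (hZ : ∀ i, Measurable (Z i))
    (h : IsPoissonProcess (fun B ω => {i : ℕ | Z i ω ∈ B}.encard) ν P) :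
    Measure.sum (fun p : ℕ × ℕ => P.map (fun ω => (Z p.1 ω, Z p.2 ω))) =
      ν.prod ν + ν.map (fun x => (x, x)) := by
  have hdiag : Measurable (fun x : E => (x, x)) := measurable_id.prodMk measurable_id
  have hpair : ∀ p : ℕ × ℕ, Measurable (fun ω => (Z p.1 ω, Z p.2 ω)) :=
    fun p => (hZ p.1).prodMk (hZ p.2)
  have hcov : ⋃ k, spanningSets ν k ×ˢ spanningSets ν k = (univ : Set (E × E)) := by
    rw [iUnion_prod_of_monotone (monotone_spanningSets ν) (monotone_spanningSets ν),
      iUnion_spanningSets, univ_prod_univ]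
  rw [Measure.ext_iff_of_iUnion_eq_univ hcov]
  intro k
  have hk := measurableSet_spanningSets ν k
  have hkk := hk.prod hk
  -- Rectangles determine a finite measure on a product, so it suffices to compare rectangles inside
  -- each square of finite measure.
  have key : ∀ s t : Set E, MeasurableSet s → MeasurableSet t →
      (Measure.sum (fun p : ℕ × ℕ => P.map (fun ω => (Z p.1 ω, Z p.2 ω)))).restrict
        (spanningSets ν k ×ˢ spanningSets ν k) (s ×ˢ t) =
      (ν.prod ν + ν.map (fun x => (x, x))).restrict
        (spanningSets ν k ×ˢ spanningSets ν k) (s ×ˢ t) := by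
    intro s t hs ht
    rw [Measure.restrict_apply (hs.prod ht), Measure.restrict_apply (hs.prod ht), prod_inter_prod]
    have hA := hs.inter hk
    have hB := ht.inter hk
    set A := s ∩ spanningSets ν k
    set B := t ∩ spanningSets ν k
    have fA : ν A ≠ ⊤ :=
      measure_ne_top_of_subset inter_subset_right (measure_spanningSets_lt_top ν k).ne
    have fB : ν B ≠ ⊤ :=
      measure_ne_top_of_subset inter_subset_right (measure_spanningSets_lt_top ν k).ne
    rw [Measure.add_apply, Measure.prod_prod, Measure.map_apply hdiag (hA.prod hB),
      mk_preimage_prod, preimage_id', preimage_id', ← h.lintegral_pointCount_mul hZ hA hB fA fB,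
      Measure.sum_apply _ (hA.prod hB)]
    have e : ∀ ω, pointCount Z A ω * pointCount Z B ω =
        ∑' p : ℕ × ℕ, (A ×ˢ B).indicator 1 (Z p.1 ω, Z p.2 ω) := by
      intro ω
      simp only [pointCount]
      rw [ENNReal.tsum_prod (f := fun i j => (A ×ˢ B).indicator 1 (Z i ω, Z j ω)),
        ← ENNReal.tsum_mul_right]
      refine tsum_congr fun i => ?_
      rw [← ENNReal.tsum_mul_left]
      refine tsum_congr fun j => ?_
      by_cases h1 : Z i ω ∈ A <;> by_cases h2 : Z j ω ∈ B <;> simp [h1, h2, indicator]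
    simp_rw [e]
    rw [lintegral_tsum (f := fun (p : ℕ × ℕ) ω => (A ×ˢ B).indicator 1 (Z p.1 ω, Z p.2 ω)) fun p =>
      ((measurable_one.indicator (hA.prod hB)).comp (hpair p)).aemeasurable]
    refine tsum_congr fun p => ?_
    rw [← lintegral_map (measurable_one.indicator (hA.prod hB)) (hpair p),
      lintegral_indicator_one (hA.prod hB)]
  have hfin : IsFiniteMeasure ((ν.prod ν + ν.map (fun x => (x, x))).restrict
      (spanningSets ν k ×ˢ spanningSets ν k)) := by
    refine ⟨?_⟩
    rw [Measure.restrict_apply MeasurableSet.univ, univ_inter, Measure.add_apply,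
      Measure.prod_prod, Measure.map_apply hdiag hkk, mk_preimage_prod, preimage_id', inter_self]
    have := measure_spanningSets_lt_top ν k
    exact ENNReal.add_lt_top.2 ⟨ENNReal.mul_lt_top this this, this⟩
  have hfin' : IsFiniteMeasure ((Measure.sum (fun p : ℕ × ℕ =>
      P.map (fun ω => (Z p.1 ω, Z p.2 ω)))).restrict
      (spanningSets ν k ×ˢ spanningSets ν k)) := by
    refine ⟨?_⟩
    rw [← univ_prod_univ, key _ _ MeasurableSet.univ MeasurableSet.univ]
    exact measure_lt_top _ _
  exact Measure.ext_prod fun {s} {t} hs ht => key s t hs ht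

end PointCount

/-! ### Moments of the unit exponential law -/

theorem measurable_gammaPDF (a r : ℝ) : Measurable (gammaPDF a r) :=
  (measurable_gammaPDFReal a r).ennreal_ofReal

theorem lintegral_expMeasure_one (φ : ℝ → ℝ≥0∞) (hφ : Measurable φ) :
    ∫⁻ x, φ x ∂(expMeasure 1) = ∫⁻ x, gammaPDF 1 1 x * φ x := by
  rw [expMeasure, gammaMeasure, lintegral_withDensity_eq_lintegral_mul _
    (measurable_gammaPDF 1 1) hφ]
  rfl

/-- Multiplying the exponential density by `x` gives the Gamma density of shape 2, and multiplying
it by `x²` gives twice that of shape 3. So both moments can be read off from the total mass of a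
Gamma law. -/
theorem lintegral_ofReal_expMeasure_one : ∫⁻ x, ENNReal.ofReal x ∂(expMeasure 1) = 1 := by
  rw [lintegral_expMeasure_one _ ENNReal.measurable_ofReal,
    ← lintegral_gammaPDF_eq_one (a := 2) (r := 1) (by norm_num) (by norm_num)]
  refine lintegral_congr fun x => ?_
  rcases lt_or_ge x 0 with hx | hx
  · simp [gammaPDF_of_neg hx]
  · rw [gammaPDF_of_nonneg hx, gammaPDF_of_nonneg hx, ← ENNReal.ofReal_mul (by positivity)]
    congr 1
    have : (2 : ℝ) - 1 = 1 := by norm_num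
    rw [this]
    simp
    ring

theorem lintegral_ofReal_mul_self_expMeasure_one :
    ∫⁻ x, ENNReal.ofReal x * ENNReal.ofReal x ∂(expMeasure 1) = 2 := by
  rw [lintegral_expMeasure_one (fun x => ENNReal.ofReal x * ENNReal.ofReal x) (by fun_prop)]
  have h : ∀ x : ℝ, gammaPDF 1 1 x * (ENNReal.ofReal x * ENNReal.ofReal x) =
      2 * gammaPDF 3 1 x := by
    intro x
    rcases lt_or_ge x 0 with hx | hx
    · simp [gammaPDF_of_neg hx]
    · have h2 : (2 : ℝ≥0∞) = ENNReal.ofReal 2 := by simp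
      have hG : Real.Gamma 3 = 2 := by
        have := Real.Gamma_nat_eq_factorial 2
        rwa [Nat.factorial_two, show ((2 : ℕ) : ℝ) + 1 = 3 by norm_num, Nat.cast_ofNat] at this
      rw [gammaPDF_of_nonneg hx, gammaPDF_of_nonneg hx, ← ENNReal.ofReal_mul hx,
        ← ENNReal.ofReal_mul (by positivity), h2, ← ENNReal.ofReal_mul (by positivity), hG]
      congr 1
      have : (3 : ℝ) - 1 = (2 : ℕ) := by norm_num
      rw [this, Real.rpow_natCast]
      simp
      ring
  simp_rw [h]
  rw [lintegral_const_mul _ (measurable_gammaPDF 3 1),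
    lintegral_gammaPDF_eq_one (by norm_num) (by norm_num), mul_one]

theorem ae_nonneg_expMeasure_one : ∀ᵐ x ∂(expMeasure 1), 0 ≤ x := by
  rw [expMeasure, gammaMeasure, ae_withDensity_iff (measurable_gammaPDF 1 1)]
  refine ae_of_all _ fun x hx => ?_
  by_contra hneg
  exact hx (gammaPDF_of_neg (not_le.1 hneg))

theorem integrable_id_expMeasure_one : Integrable (fun x : ℝ => x) (expMeasure 1) ∧
    ∫ x, x ∂(expMeasure 1) = 1 := by
  have h0 := ae_nonneg_expMeasure_one
  have hi : Integrable (fun x : ℝ => x) (expMeasure 1) := by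
    refine ⟨measurable_id.aestronglyMeasurable, ?_⟩
    rw [hasFiniteIntegral_iff_ofReal h0, lintegral_ofReal_expMeasure_one]
    simp
  refine ⟨hi, ?_⟩
  rw [integral_eq_lintegral_of_nonneg_ae h0 measurable_id.aestronglyMeasurable,
    lintegral_ofReal_expMeasure_one]
  simp

/-! ### Moments of marked sums -/

section MarkedSum

variable {Ω E : Type*} [MeasurableSpace Ω] [MeasurableSpace E]

/-- Marks that are independent of the points, have mean one, are uncorrelated and have second
moment at most two. -/
structure IsUnitMarking (Z : ℕ → Ω → E) (W : ℕ → Ω → ℝ≥0∞) (P : Measure Ω) : Prop where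
  measurable : ∀ i, Measurable (W i)
  indep : IndepFun (fun ω i => Z i ω) (fun ω i => W i ω) P
  mean : ∀ i, ∫⁻ ω, W i ω ∂P = 1
  second : ∀ i j, ∫⁻ ω, W i ω * W j ω ∂P ≤ 1 + if i = j then 1 else 0

variable {Z : ℕ → Ω → E} {W : ℕ → Ω → ℝ≥0∞} {ν : Measure E} {P : Measure Ω}

/-- With trivial marks, counting stations in a disc is a special case of the marked strong law. -/
theorem isUnitMarking_one (Z : ℕ → Ω → E) (P : Measure Ω) [IsProbabilityMeasure P] :
    IsUnitMarking Z (fun _ _ => 1) P where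
  measurable _ := measurable_const
  indep := indepFun_const_right _ _
  mean _ := by simp
  second _ _ := by simp

/-- Campbell's formula: the mark of each point is independent of its position and averages to one,
and the laws of the points sum to `ν`. -/
theorem IsUnitMarking.lintegral_tsum [SigmaFinite ν] (hW : IsUnitMarking Z W P)
    (hZ : ∀ i, Measurable (Z i))
    (h : IsPoissonProcess (fun B ω => {i : ℕ | Z i ω ∈ B}.encard) ν P)
    {φ : E → ℝ≥0∞} (hφ : Measurable φ) :
    ∫⁻ ω, ∑' i, φ (Z i ω) * W i ω ∂P = ∫⁻ x, φ x ∂ν := by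
  have hm : ∀ i, Measurable fun ω => φ (Z i ω) := fun i => hφ.comp (hZ i)
  rw [MeasureTheory.lintegral_tsum (f := fun i ω => φ (Z i ω) * W i ω) fun i =>
    ((hm i).mul (hW.measurable i)).aemeasurable,
    ← h.sum_map_eq hZ, lintegral_sum_measure]
  refine tsum_congr fun i => ?_
  have hi : IndepFun (fun ω => φ (Z i ω)) (W i) P :=
    hW.indep.comp (φ := fun z : ℕ → E => φ (z i)) (ψ := fun w : ℕ → ℝ≥0∞ => w i)
      (hφ.comp (measurable_pi_apply i)) (measurable_pi_apply i)
  have := lintegral_mul_eq_lintegral_mul_lintegral_of_indepFun (hm i) (hW.measurable i) hi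
  rw [hW.mean, mul_one, ← lintegral_map hφ (hZ i)] at this
  exact this

/-- Expand the square into a sum over pairs of points. The diagonal is counted twice, which explains
the factor `2`: once by the second moment measure of the process, once by the excess of the second
moment of a mark over `1`. -/
theorem IsUnitMarking.lintegral_tsum_mul_self_le [SigmaFinite ν] (hW : IsUnitMarking Z W P)
    (hZ : ∀ i, Measurable (Z i))
    (h : IsPoissonProcess (fun B ω => {i : ℕ | Z i ω ∈ B}.encard) ν P)
    {φ : E → ℝ≥0∞} (hφ : Measurable φ) :
    ∫⁻ ω, (∑' i, φ (Z i ω) * W i ω) * (∑' i, φ (Z i ω) * W i ω) ∂P ≤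
      (∫⁻ x, φ x ∂ν) * (∫⁻ x, φ x ∂ν) + 2 * ∫⁻ x, φ x * φ x ∂ν := by
  have hm : ∀ i, Measurable fun ω => φ (Z i ω) := fun i => hφ.comp (hZ i)
  have hWm := hW.measurable
  have hdiag : Measurable (fun x : E => (x, x)) := measurable_id.prodMk measurable_id
  have e : ∀ ω, (∑' i, φ (Z i ω) * W i ω) * (∑' i, φ (Z i ω) * W i ω) =
      ∑' p : ℕ × ℕ, (φ (Z p.1 ω) * φ (Z p.2 ω)) * (W p.1 ω * W p.2 ω) := fun ω => by
    rw [ENNReal.tsum_prod (f := fun i j => (φ (Z i ω) * φ (Z j ω)) * (W i ω * W j ω)),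
      ← ENNReal.tsum_mul_right]
    refine tsum_congr fun i => ?_
    rw [← ENNReal.tsum_mul_left]
    exact tsum_congr fun j => by ring
  have hφ2 : Measurable fun z : E × E => φ z.1 * φ z.2 := by fun_prop
  have hterm : ∀ p : ℕ × ℕ,
      ∫⁻ ω, (φ (Z p.1 ω) * φ (Z p.2 ω)) * (W p.1 ω * W p.2 ω) ∂P ≤
        ∫⁻ z, φ z.1 * φ z.2 ∂(P.map (fun ω => (Z p.1 ω, Z p.2 ω))) +
        if p.1 = p.2 then ∫⁻ x, φ x * φ x ∂(P.map (Z p.1)) else 0 := by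
    rintro ⟨i, j⟩
    have hi : IndepFun (fun ω => φ (Z i ω) * φ (Z j ω)) (fun ω => W i ω * W j ω) P :=
      hW.indep.comp (φ := fun z : ℕ → E => φ (z i) * φ (z j))
        (ψ := fun w : ℕ → ℝ≥0∞ => w i * w j) (by fun_prop) (by fun_prop)
    have := lintegral_mul_eq_lintegral_mul_lintegral_of_indepFun ((hm i).mul (hm j))
      ((hWm i).mul (hWm j)) hi
    simp only [Pi.mul_apply] at this
    rw [this, lintegral_map hφ2 ((hZ i).prodMk (hZ j)), lintegral_map (by fun_prop) (hZ i)]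
    refine (mul_le_mul_right (hW.second i j) _).trans ?_
    rw [mul_add, mul_one]
    refine add_le_add le_rfl ?_
    by_cases hij : i = j
    · subst hij; simp
    · simp [hij]
  simp_rw [e]
  rw [MeasureTheory.lintegral_tsum (f := fun (p : ℕ × ℕ) ω =>
    (φ (Z p.1 ω) * φ (Z p.2 ω)) * (W p.1 ω * W p.2 ω)) fun p => (((hm p.1).mul (hm p.2)).mul
    ((hWm p.1).mul (hWm p.2))).aemeasurable]
  refine (ENNReal.tsum_le_tsum hterm).trans ?_
  rw [ENNReal.tsum_add, ← lintegral_sum_measure, h.sum_map_prod_eq hZ, lintegral_add_measure,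
    lintegral_map hφ2 hdiag, ENNReal.tsum_prod
      (f := fun i j => if i = j then ∫⁻ x, φ x * φ x ∂(P.map (Z i)) else 0)]
  have hite : ∀ (i : ℕ) (c : ℝ≥0∞), ∑' j, (if i = j then c else 0) = c := fun i c => by
    simp_rw [eq_comm (a := i)]
    exact tsum_ite_eq i _
  simp_rw [hite]
  rw [← lintegral_sum_measure, h.sum_map_eq hZ, lintegral_prod_mul hφ.aemeasurable hφ.aemeasurable,
    add_assoc, ← two_mul]

end MarkedSum

/-! ### Strong law for sums at growing density -/

/-- With `n = ⌊√x⌋`, `u x` lies between its values at `n²` and `(n + 1)²`, and the ratio of these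
consecutive squares tends to `1`. -/
theorem tendsto_div_atTop_of_monotone_of_sq {u : ℝ → ℝ} (hu : Monotone u) (hu0 : ∀ x, 0 ≤ u x)
    {m : ℝ} (h : Tendsto (fun n : ℕ => u ((n : ℝ) ^ 2) / (n : ℝ) ^ 2) atTop (𝓝 m)) :
    Tendsto (fun x => u x / x) atTop (𝓝 m) := by
  have hk : Tendsto (fun x : ℝ => ⌊√x⌋₊) atTop atTop :=
    tendsto_nat_floor_atTop.comp Real.tendsto_sqrt_atTop
  have hr : Tendsto (fun n : ℕ => ((n : ℝ) / (n + 1)) ^ 2) atTop (𝓝 1) := by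
    simpa using (tendsto_natCast_div_add_atTop (1 : ℝ)).pow 2
  have hr' : Tendsto (fun n : ℕ => (((n : ℝ) / (n + 1)) ^ 2)⁻¹) atTop (𝓝 1) := by
    simpa using hr.inv₀ one_ne_zero
  have hlow := (h.mul hr).comp hk
  have h1 : Tendsto (fun n : ℕ => u (((n : ℝ) + 1) ^ 2) / ((n : ℝ) + 1) ^ 2) atTop (𝓝 m) := by
    simpa [Function.comp_def] using h.comp (tendsto_add_atTop_nat 1)
  have hupp := (h1.mul hr').comp hk
  rw [mul_one] at hlow hupp
  have hev : ∀ᶠ x : ℝ in atTop, 1 ≤ x ∧ 1 ≤ ⌊√x⌋₊ :=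
    (eventually_ge_atTop 1).and (hk.eventually (eventually_ge_atTop 1))
  refine tendsto_of_tendsto_of_tendsto_of_le_of_le' hlow hupp ?_ ?_
  · filter_upwards [hev] with x ⟨hx, hn⟩
    simp only [Function.comp_apply]
    set n := ⌊√x⌋₊
    have hn' : (1 : ℝ) ≤ n := by exact_mod_cast hn
    have ha : (n : ℝ) ^ 2 ≤ x := by
      have := Nat.floor_le (Real.sqrt_nonneg x)
      calc (n : ℝ) ^ 2 ≤ √x ^ 2 := by gcongr
        _ = x := Real.sq_sqrt (by linarith)
    have hb : x ≤ ((n : ℝ) + 1) ^ 2 := by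
      have := (Nat.lt_floor_add_one (√x)).le
      calc x = √x ^ 2 := (Real.sq_sqrt (by linarith)).symm
        _ ≤ _ := by gcongr
    calc u ((n : ℝ) ^ 2) / (n : ℝ) ^ 2 * ((n : ℝ) / (n + 1)) ^ 2
        = u ((n : ℝ) ^ 2) / ((n : ℝ) + 1) ^ 2 := by field_simp
      _ ≤ u x / x := div_le_div₀ (hu0 _) (hu ha) (by linarith) hb
  · filter_upwards [hev] with x ⟨hx, hn⟩
    simp only [Function.comp_apply]
    set n := ⌊√x⌋₊
    have hn' : (1 : ℝ) ≤ n := by exact_mod_cast hn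
    have ha : (n : ℝ) ^ 2 ≤ x := by
      have := Nat.floor_le (Real.sqrt_nonneg x)
      calc (n : ℝ) ^ 2 ≤ √x ^ 2 := by gcongr
        _ = x := Real.sq_sqrt (by linarith)
    have hb : x ≤ ((n : ℝ) + 1) ^ 2 := by
      have := (Nat.lt_floor_add_one (√x)).le
      calc x = √x ^ 2 := (Real.sq_sqrt (by linarith)).symm
        _ ≤ _ := by gcongr
    calc u x / x ≤ u (((n : ℝ) + 1) ^ 2) / (n : ℝ) ^ 2 :=
          div_le_div₀ (hu0 _) (hu hb) (by positivity) ha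
      _ = _ := by field_simp

section DensitySum

variable {Ω α : Type*}

/-- The sum of `φ` over the points that are present at density `ρ`, with weights `W`. -/
noncomputable def densitySum (X : ℕ → Ω → α) (T : ℕ → Ω → ℝ) (φ : α → ℝ≥0∞) (W : ℕ → Ω → ℝ≥0∞)
    (ρ : ℝ) (ω : Ω) : ℝ≥0∞ :=
  ∑' i, {i : ℕ | T i ω ≤ ρ}.indicator (fun i => φ (X i ω) * W i ω) i

theorem densitySum_mono (X : ℕ → Ω → α) (T : ℕ → Ω → ℝ) (φ : α → ℝ≥0∞) (W : ℕ → Ω → ℝ≥0∞)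
    (ω : Ω) : Monotone fun ρ => densitySum X T φ W ρ ω := fun _ _ hab =>
  ENNReal.tsum_le_tsum fun _ => indicator_le_indicator_of_subset (fun _ hi => hi.trans hab)
    (fun _ => zero_le) _

theorem densitySum_eq (X : ℕ → Ω → α) (T : ℕ → Ω → ℝ) (φ : α → ℝ≥0∞) (W : ℕ → Ω → ℝ≥0∞)
    (ρ : ℝ) (ω : Ω) : densitySum X T φ W ρ ω =
      ∑' i, (fun z : α × ℝ => φ z.1 * (Iic ρ).indicator 1 z.2) (X i ω, T i ω) * W i ω := by
  refine tsum_congr fun i => ?_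
  by_cases h : T i ω ≤ ρ <;> simp [h, indicator]

variable [MeasurableSpace Ω] [MeasurableSpace α] {X : ℕ → Ω → α} {T : ℕ → Ω → ℝ}
  {μ : Measure α} {P : Measure Ω} {W : ℕ → Ω → ℝ≥0∞} {φ : α → ℝ≥0∞}

theorem lintegral_mul_indicator_Iic [SigmaFinite μ] (hφ : Measurable φ) (ρ : ℝ) :
    ∫⁻ z : α × ℝ, φ z.1 * (Iic ρ).indicator 1 z.2 ∂(μ.prod (volume.restrict (Ioi (0 : ℝ)))) =
      (∫⁻ x, φ x ∂μ) * ENNReal.ofReal ρ := by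
  rw [lintegral_prod_mul (g := (Iic ρ).indicator 1) hφ.aemeasurable
    (measurable_one.indicator measurableSet_Iic).aemeasurable,
    lintegral_indicator_one measurableSet_Iic, Measure.restrict_apply measurableSet_Iic,
    Iic_inter_Ioi, Real.volume_Ioc, sub_zero]

theorem lintegral_densitySum [SigmaFinite μ] (hX : ∀ i, Measurable (X i))
    (hT : ∀ i, Measurable (T i))
    (h : IsPoissonProcess (fun (B : Set (α × ℝ)) ω => {i : ℕ | (X i ω, T i ω) ∈ B}.encard)
      (μ.prod (volume.restrict (Ioi (0 : ℝ)))) P)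
    (hW : IsUnitMarking (fun i ω => (X i ω, T i ω)) W P) (hφ : Measurable φ) (ρ : ℝ) :
    ∫⁻ ω, densitySum X T φ W ρ ω ∂P = (∫⁻ x, φ x ∂μ) * ENNReal.ofReal ρ := by
  have hm : Measurable fun z : α × ℝ => φ z.1 * (Iic ρ).indicator 1 z.2 :=
    (hφ.comp measurable_fst).mul ((measurable_one.indicator measurableSet_Iic).comp measurable_snd)
  simp_rw [densitySum_eq X T φ W ρ]
  rw [← lintegral_mul_indicator_Iic hφ ρ]
  exact hW.lintegral_tsum (fun i => (hX i).prodMk (hT i)) h hm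

theorem lintegral_densitySum_sq_le [SigmaFinite μ] (hX : ∀ i, Measurable (X i))
    (hT : ∀ i, Measurable (T i))
    (h : IsPoissonProcess (fun (B : Set (α × ℝ)) ω => {i : ℕ | (X i ω, T i ω) ∈ B}.encard)
      (μ.prod (volume.restrict (Ioi (0 : ℝ)))) P)
    (hW : IsUnitMarking (fun i ω => (X i ω, T i ω)) W P) (hφ : Measurable φ) (ρ : ℝ) :
    ∫⁻ ω, densitySum X T φ W ρ ω * densitySum X T φ W ρ ω ∂P ≤
      ((∫⁻ x, φ x ∂μ) * ENNReal.ofReal ρ) * ((∫⁻ x, φ x ∂μ) * ENNReal.ofReal ρ) +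
        2 * ((∫⁻ x, φ x * φ x ∂μ) * ENNReal.ofReal ρ) := by
  have hm : Measurable fun z : α × ℝ => φ z.1 * (Iic ρ).indicator 1 z.2 :=
    (hφ.comp measurable_fst).mul ((measurable_one.indicator measurableSet_Iic).comp measurable_snd)
  simp_rw [densitySum_eq X T φ W ρ]
  refine (hW.lintegral_tsum_mul_self_le (fun i => (hX i).prodMk (hT i)) h hm).trans ?_
  rw [lintegral_mul_indicator_Iic hφ ρ, ← lintegral_mul_indicator_Iic (φ := fun x => φ x * φ x) (hφ.mul hφ) ρ]
  refine le_of_eq ?_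
  congr 3
  funext z
  by_cases hz : z.2 ≤ ρ <;> simp [hz, indicator]

theorem measurable_densitySum (hX : ∀ i, Measurable (X i)) (hT : ∀ i, Measurable (T i))
    (hW : ∀ i, Measurable (W i)) (hφ : Measurable φ) (ρ : ℝ) :
    Measurable (densitySum X T φ W ρ) := by
  have : densitySum X T φ W ρ = fun ω => ∑' i,
      (fun z : α × ℝ => φ z.1 * (Iic ρ).indicator 1 z.2) (X i ω, T i ω) * W i ω :=
    funext fun ω => densitySum_eq X T φ W ρ ω
  rw [this]
  refine Measurable.tsum fun i => Measurable.mul ?_ (hW i)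
  exact (hφ.comp (hX i)).mul ((measurable_one.indicator measurableSet_Iic).comp (hT i))

theorem ae_densitySum_ne_top [SigmaFinite μ] (hX : ∀ i, Measurable (X i))
    (hT : ∀ i, Measurable (T i))
    (h : IsPoissonProcess (fun (B : Set (α × ℝ)) ω => {i : ℕ | (X i ω, T i ω) ∈ B}.encard)
      (μ.prod (volume.restrict (Ioi (0 : ℝ)))) P)
    (hW : IsUnitMarking (fun i ω => (X i ω, T i ω)) W P) (hφ : Measurable φ)
    (h1 : ∫⁻ x, φ x ∂μ ≠ ⊤) :
    ∀ᵐ ω ∂P, ∀ ρ, densitySum X T φ W ρ ω ≠ ⊤ := by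
  -- Integer densities are countably many, and monotonicity in the density covers the rest.
  have : ∀ᵐ ω ∂P, ∀ n : ℕ, densitySum X T φ W n ω < ⊤ := by
    rw [ae_all_iff]
    intro n
    refine ae_lt_top (measurable_densitySum hX hT hW.measurable hφ n) ?_
    rw [lintegral_densitySum hX hT h hW hφ]
    exact ENNReal.mul_ne_top h1 ENNReal.ofReal_ne_top
  filter_upwards [this] with ω hω ρ
  obtain ⟨n, hn⟩ := exists_nat_ge ρ
  exact ((densitySum_mono X T φ W ω hn).trans_lt (hω n)).ne

/-- Second moment bound for the deviation of a sum over a Poisson process from its mean. -/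
theorem lintegral_ofReal_densitySum_sub_sq_le [IsProbabilityMeasure P] [SigmaFinite μ]
    (hX : ∀ i, Measurable (X i)) (hT : ∀ i, Measurable (T i))
    (h : IsPoissonProcess (fun (B : Set (α × ℝ)) ω => {i : ℕ | (X i ω, T i ω) ∈ B}.encard)
      (μ.prod (volume.restrict (Ioi (0 : ℝ)))) P)
    (hW : IsUnitMarking (fun i ω => (X i ω, T i ω)) W P) (hφ : Measurable φ)
    (h1 : ∫⁻ x, φ x ∂μ ≠ ⊤) (h2 : ∫⁻ x, φ x * φ x ∂μ ≠ ⊤) {ρ : ℝ} (hρ : 0 < ρ) :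
    ∫⁻ ω, ENNReal.ofReal (((densitySum X T φ W ρ ω).toReal / ρ - (∫⁻ x, φ x ∂μ).toReal) ^ 2) ∂P ≤
      ENNReal.ofReal (2 * (∫⁻ x, φ x * φ x ∂μ).toReal / ρ) := by
  set m := (∫⁻ x, φ x ∂μ).toReal
  set q := (∫⁻ x, φ x * φ x ∂μ).toReal
  have hS := measurable_densitySum hX hT hW.measurable hφ ρ
  have hfin := ae_densitySum_ne_top hX hT h hW hφ h1
  have e1 := lintegral_densitySum hX hT h hW hφ ρ
  have e2 := lintegral_densitySum_sq_le hX hT h hW hφ ρ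
  set S := densitySum X T φ W ρ
  have r1 : ∫⁻ x, φ x ∂μ = ENNReal.ofReal m := (ENNReal.ofReal_toReal h1).symm
  have r2 : ∫⁻ x, φ x * φ x ∂μ = ENNReal.ofReal q := (ENNReal.ofReal_toReal h2).symm
  have hm0 : 0 ≤ m := ENNReal.toReal_nonneg
  have hq0 : 0 ≤ q := ENNReal.toReal_nonneg
  rw [r1, ← ENNReal.ofReal_mul hm0] at e1
  have h22 : (2 : ℝ≥0∞) = ENNReal.ofReal 2 := by simp
  rw [r1, r2, h22, ← ENNReal.ofReal_mul hm0, ← ENNReal.ofReal_mul hq0,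
    ← ENNReal.ofReal_mul (by positivity), ← ENNReal.ofReal_mul (by positivity),
    ← ENNReal.ofReal_add (by positivity) (by positivity)] at e2
  have hint : Integrable (fun ω => (S ω).toReal) P :=
    integrable_toReal_of_lintegral_ne_top hS.aemeasurable (by rw [e1]; simp)
  have hint2 : Integrable (fun ω => (S ω).toReal ^ 2) P := by
    have := integrable_toReal_of_lintegral_ne_top (hS.mul hS).aemeasurable
      (ne_top_of_le_ne_top ENNReal.ofReal_ne_top e2)
    simpa [ENNReal.toReal_mul, sq] using this
  have i1 : ∫ ω, (S ω).toReal ∂P = m * ρ := by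
    rw [integral_toReal hS.aemeasurable (hfin.mono fun ω hω => (hω ρ).lt_top), e1,
      ENNReal.toReal_ofReal (by positivity)]
  have i2 : ∫ ω, (S ω).toReal ^ 2 ∂P ≤ m * ρ * (m * ρ) + 2 * (q * ρ) := by
    have e3 := integral_toReal (hS.mul hS).aemeasurable (hfin.mono fun ω hω =>
      ENNReal.mul_lt_top (hω ρ).lt_top (hω ρ).lt_top)
    have e4 : ∫ ω, (S ω).toReal ^ 2 ∂P = ∫ ω, ((S * S) ω).toReal ∂P := by
      simp [ENNReal.toReal_mul, sq]
    rw [e4, e3]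
    exact ENNReal.toReal_le_of_le_ofReal (by positivity) e2
  have expand : ∀ ω, ((S ω).toReal / ρ - m) ^ 2 =
      (1 / ρ ^ 2) * (S ω).toReal ^ 2 - (2 * m / ρ) * (S ω).toReal + m ^ 2 := fun ω => by
    field_simp; ring
  have hi : Integrable (fun ω => ((S ω).toReal / ρ - m) ^ 2) P := by
    simp_rw [expand]
    exact ((hint2.const_mul _).sub (hint.const_mul _)).add (integrable_const _)
  rw [← ofReal_integral_eq_lintegral_ofReal hi (ae_of_all _ fun ω => sq_nonneg _)]
  refine ENNReal.ofReal_le_ofReal ?_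
  simp_rw [expand]
  rw [integral_add (f := fun ω => (1 / ρ ^ 2) * (S ω).toReal ^ 2 - (2 * m / ρ) * (S ω).toReal)
    ((hint2.const_mul _).sub (hint.const_mul _)) (integrable_const _),
    integral_sub (hint2.const_mul _) (hint.const_mul _), integral_const_mul, integral_const_mul, i1]
  have : 1 / ρ ^ 2 * ∫ ω, (S ω).toReal ^ 2 ∂P ≤
      1 / ρ ^ 2 * (m * ρ * (m * ρ) + 2 * (q * ρ)) := by gcongr
  simp only [integral_const, probReal_univ, one_smul]
  have e5 : 1 / ρ ^ 2 * (m * ρ * (m * ρ) + 2 * (q * ρ)) = m ^ 2 + 2 * q / ρ := by field_simp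
  have e6 : 2 * m / ρ * (m * ρ) = 2 * m ^ 2 := by field_simp
  rw [e5] at this
  rw [e6]
  linarith

/-- Strong law of large numbers for sums over a Poisson process of growing density. -/
theorem ae_tendsto_densitySum_div [IsProbabilityMeasure P] [SigmaFinite μ]
    (hX : ∀ i, Measurable (X i)) (hT : ∀ i, Measurable (T i))
    (h : IsPoissonProcess (fun (B : Set (α × ℝ)) ω => {i : ℕ | (X i ω, T i ω) ∈ B}.encard)
      (μ.prod (volume.restrict (Ioi (0 : ℝ)))) P)
    (hW : IsUnitMarking (fun i ω => (X i ω, T i ω)) W P) (hφ : Measurable φ)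
    (h1 : ∫⁻ x, φ x ∂μ ≠ ⊤) (h2 : ∫⁻ x, φ x * φ x ∂μ ≠ ⊤) :
    ∀ᵐ ω ∂P, Tendsto (fun ρ => (densitySum X T φ W ρ ω).toReal / ρ) atTop
      (𝓝 (∫⁻ x, φ x ∂μ).toReal) := by
  set m := (∫⁻ x, φ x ∂μ).toReal
  set q := (∫⁻ x, φ x * φ x ∂μ).toReal
  -- Along squares the second moments of the deviations are `O(1/n²)`, so the sum of the squared
  -- deviations has finite mean. It is then almost surely finite, and its terms tend to `0`. The
  -- shift to `n + 1` avoids density zero.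
  set D : ℕ → Ω → ℝ := fun n ω =>
    (densitySum X T φ W (((n + 1 : ℕ) : ℝ) ^ 2) ω).toReal / ((n + 1 : ℕ) : ℝ) ^ 2 - m
  have hDm : ∀ n, Measurable fun ω => ENNReal.ofReal (D n ω ^ 2) := fun n =>
    (((measurable_densitySum hX hT hW.measurable hφ _).ennreal_toReal.div_const _).sub_const _
      |>.pow_const 2).ennreal_ofReal
  have hsum : ∫⁻ ω, ∑' n, ENNReal.ofReal (D n ω ^ 2) ∂P ≠ ⊤ := by
    rw [lintegral_tsum fun n => (hDm n).aemeasurable]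
    have hle : ∀ n : ℕ, ∫⁻ ω, ENNReal.ofReal (D n ω ^ 2) ∂P ≤
        ENNReal.ofReal (2 * q / ((n + 1 : ℕ) : ℝ) ^ 2) := fun n =>
      lintegral_ofReal_densitySum_sub_sq_le hX hT h hW hφ h1 h2 (by positivity)
    refine ne_top_of_le_ne_top ?_ (ENNReal.tsum_le_tsum hle)
    have hs : Summable fun n : ℕ => 2 * q / ((n + 1 : ℕ) : ℝ) ^ 2 := by
      have := (summable_nat_add_iff 1).2 (Real.summable_one_div_nat_pow.2 one_lt_two)
      simpa [div_eq_mul_inv] using this.mul_left (2 * q)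
    exact hs.tsum_ofReal_ne_top
  have hae : ∀ᵐ ω ∂P, ∑' n, ENNReal.ofReal (D n ω ^ 2) < ⊤ :=
    ae_lt_top (Measurable.tsum hDm) hsum
  filter_upwards [hae, ae_densitySum_ne_top hX hT h hW hφ h1] with ω hω hfin
  refine tendsto_div_atTop_of_monotone_of_sq (fun a b hab => ENNReal.toReal_mono (hfin b)
    (densitySum_mono X T φ W ω hab)) (fun _ => ENNReal.toReal_nonneg) ?_
  rw [← tendsto_add_atTop_iff_nat 1]
  have h0 := (ENNReal.tendsto_toReal ENNReal.zero_ne_top).comp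
    (ENNReal.tendsto_atTop_zero_of_tsum_ne_top hω.ne)
  have h3 : Tendsto (fun n => D n ω ^ 2) atTop (𝓝 0) := by
    simpa [Function.comp_def, ENNReal.toReal_ofReal, sq_nonneg] using h0
  have h4 : Tendsto (fun n => D n ω) atTop (𝓝 0) := by
    rw [tendsto_zero_iff_abs_tendsto_zero]
    have := (Real.continuous_sqrt.tendsto 0).comp h3
    simpa [Function.comp_def, Real.sqrt_sq_eq_abs] using this
  simpa [D] using h4.add_const m

end DensitySum

/-- The mean power received per unit density from outside the disc of radius `q`. -/
noncomputable def farField (L : ℝ → ℝ) (q : ℝ) : ℝ := ∫ x in {x : Plane | q ≤ ‖x‖}, L ‖x‖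

/-! ### Path loss and mean far-field power -/

namespace PhysicallyFeasible

variable {L : ℝ → ℝ}

/-- Otherwise `L` vanishes on the positive half-line, and so does `γ`. -/
theorem zero_pos (hL : PhysicallyFeasible L) : 0 < L 0 := by
  by_contra h
  have h0 : ∀ r ∈ Ioi (0 : ℝ), r * L r = 0 := fun r hr => by
    have h1 := hL.le_zero r (le_of_lt hr)
    have h2 := hL.nonneg r (le_of_lt hr)
    rw [le_antisymm (h1.trans (not_lt.1 h)) h2, mul_zero]
  have := hL.gamma_pos
  rw [pathLossGamma, setIntegral_congr_fun measurableSet_Ioi h0] at this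
  simp at this

theorem integrable_norm (hL : PhysicallyFeasible L) :
    Integrable (fun x : Plane => L ‖x‖) := by
  rw [integrable_fun_norm_addHaar (volume : Measure Plane)]
  simpa using hL.integrable

theorem farField_zero (L : ℝ → ℝ) : farField L 0 = 2 * Real.pi * pathLossGamma L := by
  have h : {x : Plane | 0 ≤ ‖x‖} = univ := by ext x; simp
  rw [farField, h, setIntegral_univ, integral_fun_norm_addHaar (volume : Measure Plane)]
  simp [pathLossGamma, measureReal_def, mul_assoc, Real.pi_nonneg]

theorem farField_eq_add (hL : PhysicallyFeasible L) {p q : ℝ} (hpq : p ≤ q) :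
    farField L p = (∫ x in {x : Plane | p ≤ ‖x‖ ∧ ‖x‖ < q}, L ‖x‖) + farField L q := by
  rw [farField, farField, ← setIntegral_union _ (measurableSet_le measurable_const measurable_norm)
    hL.integrable_norm.integrableOn hL.integrable_norm.integrableOn]
  · congr 2
    ext x
    simp only [mem_ofPred_eq, mem_union]
    constructor
    · intro h
      rcases lt_or_ge ‖x‖ q with h' | h'
      · exact Or.inl ⟨h, h'⟩
      · exact Or.inr h'
    · rintro (h | h)
      · exact h.1
      · exact hpq.trans h
  · exact disjoint_left.2 fun x hx hx' => absurd hx.2 (not_lt.2 hx')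

theorem farField_antitone (hL : PhysicallyFeasible L) : Antitone (farField L) := fun p q hpq => by
  rw [hL.farField_eq_add hpq]
  have : 0 ≤ ∫ x in {x : Plane | p ≤ ‖x‖ ∧ ‖x‖ < q}, L ‖x‖ :=
    integral_nonneg fun x => hL.nonneg _ (norm_nonneg x)
  linarith

theorem farField_nonneg (hL : PhysicallyFeasible L) (q : ℝ) : 0 ≤ farField L q :=
  integral_nonneg fun x => hL.nonneg _ (norm_nonneg x)

/-- On the annulus between the radii `L` is at most `L 0`. This serves both as a modulus of
continuity and, with `p = 0`, as the source of the upper bound on the limiting SINR. -/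
theorem farField_le_add (hL : PhysicallyFeasible L) {p q : ℝ} (hp : 0 ≤ p) (hpq : p ≤ q) :
    farField L p ≤ farField L q + L 0 * (Real.pi * (q ^ 2 - p ^ 2)) := by
  rw [hL.farField_eq_add hpq, add_comm]
  gcongr
  have hset : {x : Plane | p ≤ ‖x‖ ∧ ‖x‖ < q} = Metric.ball 0 q \ Metric.ball 0 p := by
    ext x; simp [and_comm]
  have hvol : ∀ r : ℝ, 0 ≤ r →
      (volume : Measure Plane).real (Metric.ball 0 r) = Real.pi * r ^ 2 := fun r hr => by
    simp [measureReal_def, ENNReal.toReal_ofReal hr, Real.pi_nonneg, mul_comm]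
  have hfin : (volume : Measure Plane) (Metric.ball 0 q \ Metric.ball 0 p) ≠ ⊤ :=
    measure_ne_top_of_subset sdiff_subset measure_ball_lt_top.ne
  rw [hset]
  calc ∫ x in Metric.ball (0 : Plane) q \ Metric.ball 0 p, L ‖x‖
      ≤ ∫ x in Metric.ball (0 : Plane) q \ Metric.ball 0 p, L 0 :=
        integral_mono hL.integrable_norm.integrableOn (integrableOn_const hfin)
          fun x => hL.le_zero _ (norm_nonneg x)
    _ = _ := by
        rw [setIntegral_const, measureReal_sdiff (Metric.ball_subset_ball hpq) measurableSet_ball,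
          hvol q (hp.trans hpq), hvol p hp, smul_eq_mul]
        ring

/-- A bounded measurable version of the path loss. -/
theorem exists_measurable (hL : PhysicallyFeasible L) :
    ∃ φ : Plane → ℝ≥0∞, Measurable φ ∧ (∀ x, φ x ≤ ENNReal.ofReal (L 0)) ∧
      φ =ᵐ[volume] fun x => ENNReal.ofReal (L ‖x‖) := by
  have hm := hL.integrable_norm.aestronglyMeasurable.aemeasurable.ennreal_ofReal
  -- Integrability supplies measurability only up to null sets; the truncation restores the bound by
  -- `L 0` at every point.
  refine ⟨fun x => min (hm.mk _ x) (ENNReal.ofReal (L 0)), hm.measurable_mk.min measurable_const,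
    fun x => min_le_right _ _, ?_⟩
  filter_upwards [hm.ae_eq_mk] with x hx
  rw [← hx]
  exact min_eq_left (ENNReal.ofReal_le_ofReal (hL.le_zero _ (norm_nonneg x)))

theorem lintegral_indicator (hL : PhysicallyFeasible L) {φ : Plane → ℝ≥0∞}
    (hφ : φ =ᵐ[volume] fun x => ENNReal.ofReal (L ‖x‖)) (q : ℝ) :
    ∫⁻ x, {x : Plane | q ≤ ‖x‖}.indicator φ x = ENNReal.ofReal (farField L q) := by
  rw [MeasureTheory.lintegral_indicator (measurableSet_le measurable_const measurable_norm),
    farField, ofReal_integral_eq_lintegral_ofReal hL.integrable_norm.integrableOn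
      (ae_of_all _ fun x => hL.nonneg _ (norm_nonneg x))]
  exact lintegral_congr_ae (ae_restrict_of_ae hφ)

end PhysicallyFeasible

/-! ### Almost sure limits for discs, far field and antenna gains -/

namespace IsDensifyingNetwork

variable {Ω : Type*} [MeasurableSpace Ω] {P : Measure Ω} {X : ℕ → Ω → Plane} {T : ℕ → Ω → ℝ}
  {g f : ℕ → Ω → ℝ}

theorem isUnitMarking (h : IsDensifyingNetwork P X T g f) :
    IsUnitMarking (fun i ω => (X i ω, T i ω)) (fun i ω => ENNReal.ofReal (g i ω)) P where
  measurable i := (h.measurable_g i).ennreal_ofReal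
  indep := h.indep_positions.comp (φ := id)
    (ψ := fun w : ℕ ⊕ ℕ → ℝ => fun i => ENNReal.ofReal (w (Sum.inl i))) measurable_id
    (by fun_prop)
  mean i := by
    rw [(h.law_g i).lintegral_comp ENNReal.measurable_ofReal.aemeasurable,
      lintegral_ofReal_expMeasure_one]
  second i j := by
    by_cases hij : i = j
    · subst hij
      rw [(h.law_g i).lintegral_comp (f := fun x => ENNReal.ofReal x * ENNReal.ofReal x)
        (by fun_prop), lintegral_ofReal_mul_self_expMeasure_one]
      simp [one_add_one_eq_two]
    · have hind := (h.indep_gains.indepFun (Sum.inl_injective.ne hij)).comp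
        ENNReal.measurable_ofReal ENNReal.measurable_ofReal
      have := lintegral_mul_eq_lintegral_mul_lintegral_of_indepFun
        (h.measurable_g i).ennreal_ofReal (h.measurable_g j).ennreal_ofReal hind
      simp only [Pi.mul_apply] at this
      rw [this, (h.law_g i).lintegral_comp ENNReal.measurable_ofReal.aemeasurable,
        (h.law_g j).lintegral_comp ENNReal.measurable_ofReal.aemeasurable,
        lintegral_ofReal_expMeasure_one]
      simp

/-- The laws of the points sum to the intensity measure, so no station falls into a null set of the
plane. This lets `L` be replaced by a measurable version. -/
theorem ae_of_ae_volume (h : IsDensifyingNetwork P X T g f) {p : Plane → Prop}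
    (hp : ∀ᵐ x, p x) : ∀ᵐ ω ∂P, ∀ i, p (X i ω) := by
  rw [ae_all_iff]
  intro i
  have hZ : ∀ i, Measurable fun ω => (X i ω, T i ω) :=
    fun i => (h.measurable_X i).prodMk (h.measurable_T i)
  have h1 : ∀ᵐ z ∂((volume : Measure Plane).prod (volume.restrict (Ioi (0 : ℝ)))), p z.1 :=
    Measure.quasiMeasurePreserving_fst.ae hp
  rw [← h.poisson.sum_map_eq hZ, Measure.ae_sum_iff] at h1
  exact ae_of_ae_map (hZ i).aemeasurable (h1 i)

theorem ae_gain_nonneg (h : IsDensifyingNetwork P X T g f) : ∀ᵐ ω ∂P, ∀ i, 0 ≤ g i ω := by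
  rw [ae_all_iff]
  intro i
  have h0 := ae_nonneg_expMeasure_one
  rw [← (h.law_g i).map_eq] at h0
  exact ae_of_ae_map (h.law_g i).aemeasurable h0

theorem ae_tendsto_sum_antenna_div (h : IsDensifyingNetwork P X T g f) :
    ∀ᵐ ω ∂P, Tendsto (fun n : ℕ => (∑ i ∈ Finset.range n, f i ω) / n) atTop (𝓝 1) := by
  have hmean : P[f 0] = 1 := by
    rw [(h.law_f 0).integral_eq, integrable_id_expMeasure_one.2]
  rw [← hmean]
  refine strong_law_ae_real f ?_ (fun i j hij => ?_) fun i =>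
    ⟨(h.law_f i).aemeasurable, (h.law_f 0).aemeasurable, by
      rw [(h.law_f i).map_eq, (h.law_f 0).map_eq]⟩
  · have := integrable_id_expMeasure_one.1
    rw [← (h.law_f 0).map_eq, integrable_map_measure (g := fun x : ℝ => x) measurable_id.aestronglyMeasurable
      (h.law_f 0).aemeasurable] at this
    exact this
  · exact h.indep_gains.indepFun (Sum.inr_injective.ne hij)

/-- The number of base stations in a disc grows proportionally to the density. -/
theorem ae_tendsto_ncard_div [IsProbabilityMeasure P] (h : IsDensifyingNetwork P X T g f) {q : ℝ}
    (hq : 0 ≤ q) :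
    ∀ᵐ ω ∂P, (∀ ρ, {i : ℕ | T i ω ≤ ρ ∧ ‖X i ω‖ ≤ q}.Finite) ∧
      Tendsto (fun ρ => ({i : ℕ | T i ω ≤ ρ ∧ ‖X i ω‖ ≤ q}.ncard : ℝ) / ρ) atTop
        (𝓝 (Real.pi * q ^ 2)) := by
  have hm : Measurable ((Metric.closedBall (0 : Plane) q).indicator (1 : Plane → ℝ≥0∞)) :=
    measurable_one.indicator measurableSet_closedBall
  have hI : ∫⁻ x, (Metric.closedBall (0 : Plane) q).indicator (1 : Plane → ℝ≥0∞) x =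
      ENNReal.ofReal (Real.pi * q ^ 2) := by
    rw [lintegral_indicator_one measurableSet_closedBall]
    simp [ENNReal.ofReal_mul Real.pi_nonneg, ENNReal.ofReal_pow hq, mul_comm]
  have hI2 : ∀ x, (Metric.closedBall (0 : Plane) q).indicator (1 : Plane → ℝ≥0∞) x *
      (Metric.closedBall (0 : Plane) q).indicator (1 : Plane → ℝ≥0∞) x =
      (Metric.closedBall (0 : Plane) q).indicator (1 : Plane → ℝ≥0∞) x := fun x => by
    by_cases hx : x ∈ Metric.closedBall (0 : Plane) q <;> simp [indicator, hx]
  have hW := isUnitMarking_one (fun i ω => (X i ω, T i ω)) P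
  have hencard : ∀ ω ρ, densitySum X T ((Metric.closedBall (0 : Plane) q).indicator 1)
      (fun _ _ => 1) ρ ω = ({i : ℕ | T i ω ≤ ρ ∧ ‖X i ω‖ ≤ q}.encard : ℝ≥0∞) := fun ω ρ => by
    have := pointCount_eq_encard (fun i ω => (X i ω, T i ω)) (Metric.closedBall 0 q ×ˢ Iic ρ) ω
    simp only [mem_prod, mem_closedBall_zero_iff, mem_Iic] at this
    simp_rw [and_comm (a := T _ ω ≤ ρ)]
    rw [← this, densitySum, pointCount]
    refine tsum_congr fun i => ?_
    by_cases h1 : T i ω ≤ ρ <;> by_cases h2 : ‖X i ω‖ ≤ q <;> simp [indicator, h1, h2]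
  have hfin : ∫⁻ x, (Metric.closedBall (0 : Plane) q).indicator (1 : Plane → ℝ≥0∞) x ≠ ⊤ := by
    rw [hI]; exact ENNReal.ofReal_ne_top
  filter_upwards [ae_densitySum_ne_top h.measurable_X h.measurable_T h.poisson hW hm hfin,
    ae_tendsto_densitySum_div h.measurable_X h.measurable_T h.poisson hW hm hfin
      (by simp_rw [hI2]; exact hfin)] with ω h1 h2
  simp_rw [hencard] at h1 h2
  have hf : ∀ ρ, {i : ℕ | T i ω ≤ ρ ∧ ‖X i ω‖ ≤ q}.Finite := fun ρ => by
    rw [← encard_ne_top_iff]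
    exact fun htop => h1 ρ (by simp [htop])
  refine ⟨hf, ?_⟩
  rw [hI, ENNReal.toReal_ofReal (by positivity)] at h2
  convert! h2 using 3 with ρ
  rw [← (hf ρ).cast_ncard_eq]
  simp

/-- The power received from outside a disc grows proportionally to the density. -/
theorem ae_tendsto_tsum_div [IsProbabilityMeasure P] (h : IsDensifyingNetwork P X T g f)
    {L : ℝ → ℝ} (hL : PhysicallyFeasible L) (q : ℝ) :
    ∀ᵐ ω ∂P, (∀ ρ, Summable ({i : ℕ | T i ω ≤ ρ ∧ q ≤ ‖X i ω‖}.indicator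
        fun i => L ‖X i ω‖ * g i ω)) ∧
      Tendsto (fun ρ => (∑' i, {i : ℕ | T i ω ≤ ρ ∧ q ≤ ‖X i ω‖}.indicator
        (fun i => L ‖X i ω‖ * g i ω) i) / ρ) atTop (𝓝 (farField L q)) := by
  obtain ⟨φ, hφm, hφle, hφ⟩ := hL.exists_measurable
  have hset : MeasurableSet {x : Plane | q ≤ ‖x‖} :=
    measurableSet_le measurable_const measurable_norm
  set ψ := {x : Plane | q ≤ ‖x‖}.indicator φ
  have hψm : Measurable ψ := hφm.indicator hset
  have hI : ∫⁻ x, ψ x = ENNReal.ofReal (farField L q) := hL.lintegral_indicator hφ q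
  have hfin : ∫⁻ x, ψ x ≠ ⊤ := by rw [hI]; exact ENNReal.ofReal_ne_top
  -- Boundedness of the path loss enters here: `ψ² ≤ L 0 · ψ`, so the second moment is finite as
  -- soon as the first is.
  have hfin2 : ∫⁻ x, ψ x * ψ x ≠ ⊤ := by
    have hle : ∫⁻ x, ψ x * ψ x ≤ ∫⁻ x, ENNReal.ofReal (L 0) * ψ x := by
      refine lintegral_mono fun x => mul_le_mul_left ?_ _
      exact (indicator_le_self' (fun _ _ => zero_le) x).trans (hφle x)
    rw [lintegral_const_mul _ hψm] at hle
    exact ne_top_of_le_ne_top (ENNReal.mul_ne_top ENNReal.ofReal_ne_top hfin) hle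
  filter_upwards [
    ae_densitySum_ne_top h.measurable_X h.measurable_T h.poisson h.isUnitMarking hψm hfin,
    ae_tendsto_densitySum_div h.measurable_X h.measurable_T h.poisson h.isUnitMarking hψm hfin
      hfin2, h.ae_gain_nonneg, h.ae_of_ae_volume hφ] with ω h1 h2 hg hXφ
  have hterm : ∀ ρ i, ({i : ℕ | T i ω ≤ ρ}.indicator
      (fun i => ψ (X i ω) * ENNReal.ofReal (g i ω)) i).toReal =
      {i : ℕ | T i ω ≤ ρ ∧ q ≤ ‖X i ω‖}.indicator (fun i => L ‖X i ω‖ * g i ω) i := by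
    intro ρ i
    by_cases hi : T i ω ≤ ρ <;> by_cases hj : q ≤ ‖X i ω‖ <;>
      simp [ψ, indicator, hi, hj, hXφ i, ENNReal.toReal_mul, hg i,
        hL.nonneg _ (norm_nonneg (X i ω))]
  have hsum : ∀ ρ, (densitySum X T ψ (fun i ω => ENNReal.ofReal (g i ω)) ρ ω).toReal =
      ∑' i, {i : ℕ | T i ω ≤ ρ ∧ q ≤ ‖X i ω‖}.indicator (fun i => L ‖X i ω‖ * g i ω) i := by
    intro ρ
    rw [densitySum, ENNReal.tsum_toReal_eq (ENNReal.ne_top_of_tsum_ne_top (h1 ρ))]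
    exact tsum_congr (hterm ρ)
  constructor
  · intro ρ
    exact (ENNReal.summable_toReal (h1 ρ)).congr (hterm ρ)
  · rw [hI, ENNReal.toReal_ofReal (hL.farField_nonneg q)] at h2
    exact h2.congr fun ρ => by rw [hsum]

end IsDensifyingNetwork

/-! ### Limits of ordered distances -/

section OrderedDist

variable {Ω : Type*} {X : ℕ → Ω → Plane} {T : ℕ → Ω → ℝ} {ω : Ω}

theorem orderedDist_nonneg (X : ℕ → Ω → Plane) (T : ℕ → Ω → ℝ) (ρ : ℝ) (n : ℕ) (ω : Ω) :
    0 ≤ orderedDist X T ρ n ω :=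
  Real.sInf_nonneg fun _ hr => hr.1

theorem orderedDist_le {ρ r : ℝ} {n : ℕ} (hr : 0 ≤ r)
    (h : (n : ℕ∞) < {i : ℕ | T i ω ≤ ρ ∧ ‖X i ω‖ ≤ r}.encard) : orderedDist X T ρ n ω ≤ r :=
  csInf_le ⟨0, fun _ hs => hs.1⟩ ⟨hr, h⟩

/-- The radius `s` only certifies that the set of admissible radii is nonempty; the infimum of the
empty set would be the default value `0`. -/
theorem le_orderedDist {ρ r s : ℝ} {n : ℕ} (hs : 0 ≤ s)
    (hns : (n : ℕ∞) < {i : ℕ | T i ω ≤ ρ ∧ ‖X i ω‖ ≤ s}.encard)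
    (h : {i : ℕ | T i ω ≤ ρ ∧ ‖X i ω‖ ≤ r}.encard ≤ n) : r ≤ orderedDist X T ρ n ω := by
  refine le_csInf ⟨s, hs, hns⟩ fun t ht => ?_
  by_contra htr
  refine absurd ht.2 (not_lt.2 (le_trans (encard_le_encard fun i hi => ?_) h))
  exact ⟨hi.1, hi.2.trans (not_le.1 htr).le⟩

/-- If the number of points in discs grows like that of a homogeneous point process, the distance
to the point of index `k ρ` converges as soon as `k ρ / ρ` does. -/
theorem tendsto_orderedDist
    (hcount : ∀ q : ℚ, 0 ≤ q → (∀ ρ, {i : ℕ | T i ω ≤ ρ ∧ ‖X i ω‖ ≤ q}.Finite) ∧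
      Tendsto (fun ρ => ({i : ℕ | T i ω ≤ ρ ∧ ‖X i ω‖ ≤ q}.ncard : ℝ) / ρ) atTop
        (𝓝 (Real.pi * (q : ℝ) ^ 2)))
    {k : ℝ → ℕ} {a : ℝ} (ha : 0 ≤ a)
    (hk : Tendsto (fun ρ => (k ρ : ℝ) / ρ) atTop (𝓝 (Real.pi * a ^ 2))) :
    Tendsto (fun ρ => orderedDist X T ρ (k ρ) ω) atTop (𝓝 a) := by
  have hpi := Real.pi_pos
  -- A disc of radius `q > a` holds about `π q² ρ` points, eventually more than `k ρ ∼ π a² ρ`.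
  have habove : ∀ q : ℚ, a < q → ∀ᶠ ρ in atTop,
      (k ρ : ℕ∞) < {i : ℕ | T i ω ≤ ρ ∧ ‖X i ω‖ ≤ q}.encard := by
    intro q hq
    have hq0 : (0 : ℚ) ≤ q := by exact_mod_cast ha.trans hq.le
    obtain ⟨hf, ht⟩ := hcount q hq0
    have hlt : Real.pi * a ^ 2 < Real.pi * (q : ℝ) ^ 2 := by gcongr
    filter_upwards [hk.eventually_lt ht hlt, eventually_gt_atTop 0] with ρ h1 h2
    rw [← (hf ρ).cast_ncard_eq]
    rw [div_lt_div_iff_of_pos_right h2] at h1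
    exact_mod_cast h1
  rw [tendsto_order]
  constructor
  · intro b hb
    rcases lt_or_ge b 0 with hb0 | hb0
    · exact Eventually.of_forall fun ρ => hb0.trans_le (orderedDist_nonneg X T ρ _ ω)
    · obtain ⟨q, hbq, hqa⟩ := exists_rat_btwn hb
      obtain ⟨s, has, -⟩ := exists_rat_btwn (lt_add_one a)
      have hq0 : (0 : ℝ) ≤ q := hb0.trans hbq.le
      obtain ⟨hf, ht⟩ := hcount q (by exact_mod_cast hq0)
      have hlt : Real.pi * (q : ℝ) ^ 2 < Real.pi * a ^ 2 := by gcongr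
      filter_upwards [ht.eventually_lt hk hlt, eventually_gt_atTop 0, habove s has]
        with ρ h1 h2 h3
      refine hbq.trans_le (le_orderedDist (ha.trans has.le) h3 ?_)
      rw [← (hf ρ).cast_ncard_eq]
      rw [div_lt_div_iff_of_pos_right h2] at h1
      exact_mod_cast h1.le
  · intro b hb
    obtain ⟨q, haq, hqb⟩ := exists_rat_btwn hb
    filter_upwards [habove q haq] with ρ h
    exact (orderedDist_le (ha.trans haq.le) h).trans_lt hqb

end OrderedDist

/-! ### Residual interference beyond a moving radius -/

section Interference

variable {Ω : Type*} {X : ℕ → Ω → Plane} {T g f : ℕ → Ω → ℝ} {ω : Ω} {L : ℝ → ℝ}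

theorem residualTerm_eq (X : ℕ → Ω → Plane) (T g : ℕ → Ω → ℝ) (L : ℝ → ℝ) (N : ℝ → ℕ) (ρ : ℝ)
    (ω : Ω) : residualTerm X T g L N ρ ω =
      {i : ℕ | T i ω ≤ ρ ∧ orderedDist X T ρ (N ρ) ω ≤ ‖X i ω‖}.indicator
        fun i => L ‖X i ω‖ * g i ω := rfl

theorem summable_indicator_far (hL : PhysicallyFeasible L) (hg : ∀ i, 0 ≤ g i ω)
    (hsum : ∀ ρ, Summable ({i : ℕ | T i ω ≤ ρ ∧ 0 ≤ ‖X i ω‖}.indicator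
      fun i => L ‖X i ω‖ * g i ω)) (ρ q : ℝ) :
    Summable ({i : ℕ | T i ω ≤ ρ ∧ q ≤ ‖X i ω‖}.indicator fun i => L ‖X i ω‖ * g i ω) := by
  have h0 : ∀ i, 0 ≤ L ‖X i ω‖ * g i ω :=
    fun i => mul_nonneg (hL.nonneg _ (norm_nonneg _)) (hg i)
  have hsub : {i : ℕ | T i ω ≤ ρ ∧ q ≤ ‖X i ω‖} ⊆ {i : ℕ | T i ω ≤ ρ ∧ 0 ≤ ‖X i ω‖} :=
    fun i hi => ⟨hi.1, norm_nonneg _⟩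
  exact Summable.of_nonneg_of_le (fun i => indicator_nonneg (fun i _ => h0 i) i)
    (indicator_le_indicator_of_subset hsub h0) (hsum ρ)

/-- The residual interference per unit density converges to the mean power that is received from
outside the limiting disc. -/
theorem tendsto_residual_div (hL : PhysicallyFeasible L) (hg : ∀ i, 0 ≤ g i ω)
    (hsum : ∀ ρ, Summable ({i : ℕ | T i ω ≤ ρ ∧ 0 ≤ ‖X i ω‖}.indicator
      fun i => L ‖X i ω‖ * g i ω))
    (hfar : ∀ q : ℚ, Tendsto (fun ρ => (∑' i, {i : ℕ | T i ω ≤ ρ ∧ (q : ℝ) ≤ ‖X i ω‖}.indicator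
        (fun i => L ‖X i ω‖ * g i ω) i) / ρ) atTop (𝓝 (farField L q)))
    {d : ℝ → ℝ} (hd : ∀ ρ, 0 ≤ d ρ) {a : ℝ} (ha : Tendsto d atTop (𝓝 a)) :
    Tendsto (fun ρ => (∑' i, {i : ℕ | T i ω ≤ ρ ∧ d ρ ≤ ‖X i ω‖}.indicator
        (fun i => L ‖X i ω‖ * g i ω) i) / ρ) atTop (𝓝 (farField L a)) := by
  have h0 : ∀ i, 0 ≤ L ‖X i ω‖ * g i ω :=
    fun i => mul_nonneg (hL.nonneg _ (norm_nonneg _)) (hg i)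
  have ha0 : 0 ≤ a := ge_of_tendsto' ha hd
  have hanti : ∀ ρ p q : ℝ, p ≤ q →
      ∑' i, {i : ℕ | T i ω ≤ ρ ∧ q ≤ ‖X i ω‖}.indicator (fun i => L ‖X i ω‖ * g i ω) i ≤
      ∑' i, {i : ℕ | T i ω ≤ ρ ∧ p ≤ ‖X i ω‖}.indicator (fun i => L ‖X i ω‖ * g i ω) i := by
    intro ρ p q hpq
    have hsub : {i : ℕ | T i ω ≤ ρ ∧ q ≤ ‖X i ω‖} ⊆ {i : ℕ | T i ω ≤ ρ ∧ p ≤ ‖X i ω‖} :=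
      fun i hi => ⟨hi.1, hpq.trans hi.2⟩
    exact Summable.tsum_le_tsum (indicator_le_indicator_of_subset hsub h0)
      (summable_indicator_far hL hg hsum ρ q) (summable_indicator_far hL hg hsum ρ p)
  -- The annulus bound is small for `q` near `a`, so a rational radius on either side of `a` changes
  -- `farField` as little as desired.
  have hcont : ∀ c : ℝ, Tendsto (fun q : ℝ => c + L 0 * (Real.pi * (q ^ 2 - a ^ 2))) (𝓝 a)
      (𝓝 c) := fun c => by
    have : Continuous fun q : ℝ => c + L 0 * (Real.pi * (q ^ 2 - a ^ 2)) := by fun_prop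
    simpa using this.tendsto a
  rw [tendsto_order]
  constructor
  · intro b hb
    obtain ⟨u, hau, hu⟩ := exists_Ico_subset_of_mem_nhds
      ((hcont b).eventually (gt_mem_nhds hb)) ⟨a + 1, lt_add_one a⟩
    obtain ⟨q, haq, hqu⟩ := exists_rat_btwn hau
    have h1 : b < farField L q := by
      have h2 : b + L 0 * (Real.pi * ((q : ℝ) ^ 2 - a ^ 2)) < farField L a := hu ⟨haq.le, hqu⟩
      have h3 := hL.farField_le_add ha0 haq.le
      linarith
    filter_upwards [(hfar q).eventually (lt_mem_nhds h1), ha.eventually (gt_mem_nhds haq),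
      eventually_gt_atTop 0] with ρ h2 h3 h4
    exact h2.trans_le (div_le_div_of_nonneg_right (hanti ρ _ _ h3.le) h4.le)
  · intro b hb
    -- If `a = 0`, no smaller radius is available, but `0` itself lies below every `d ρ`. If `a >
    -- 0`, the rational is taken positive, because the annulus bound needs a nonnegative inner
    -- radius.
    have hq : ∃ q : ℚ, farField L q < b ∧ ∀ᶠ ρ in atTop, (q : ℝ) ≤ d ρ := by
      rcases ha0.eq_or_lt with rfl | hpos
      · exact ⟨0, by simpa using hb, Eventually.of_forall fun ρ => by simpa using hd ρ⟩
      · obtain ⟨l, hla, hl⟩ := exists_Ioc_subset_of_mem_nhds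
          ((hcont b).eventually (lt_mem_nhds hb)) ⟨a - 1, sub_one_lt a⟩
        obtain ⟨q, hq, hqa⟩ := exists_rat_btwn (max_lt hla hpos)
        refine ⟨q, ?_, (ha.eventually (lt_mem_nhds hqa)).mono fun _ h => h.le⟩
        have h2 : farField L a < b + L 0 * (Real.pi * ((q : ℝ) ^ 2 - a ^ 2)) :=
          hl ⟨(le_max_left _ _).trans_lt hq, hqa.le⟩
        have h3 := hL.farField_le_add ((le_max_right _ _).trans hq.le) hqa.le
        linarith
    obtain ⟨q, h1, hev⟩ := hq
    filter_upwards [(hfar q).eventually (gt_mem_nhds h1), hev, eventually_gt_atTop 0]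
      with ρ h2 h3 h4
    exact (div_le_div_of_nonneg_right (hanti ρ _ _ h3) h4.le).trans_lt h2

end Interference

/-! ### Limit of the scaled SINR -/

namespace IsDensifyingNetwork

variable {Ω : Type*} [MeasurableSpace Ω] {P : Measure Ω} [IsProbabilityMeasure P]
  {X : ℕ → Ω → Plane} {T : ℕ → Ω → ℝ} {g f : ℕ → Ω → ℝ} {L : ℝ → ℝ}

theorem ae_summable_residualTerm (h : IsDensifyingNetwork P X T g f) (hL : PhysicallyFeasible L)
    (N : ℝ → ℕ) : ∀ᵐ ω ∂P, ∀ ρ, Summable (residualTerm X T g L N ρ ω) := by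
  filter_upwards [h.ae_gain_nonneg, h.ae_tendsto_tsum_div hL 0] with ω hg h0 ρ
  rw [residualTerm_eq]
  exact summable_indicator_far hL hg h0.1 ρ _

/-- The scaled SINR converges when the number of antennas per unit density does. -/
theorem ae_tendsto_condSINR (h : IsDensifyingNetwork P X T g f) (hL : PhysicallyFeasible L)
    (hL0 : ContinuousWithinAt L (Ici 0) 0) (σ : ℝ) {N : ℝ → ℕ} (hN : Tendsto N atTop atTop)
    {a : ℝ} (ha : 0 ≤ a) (hNa : Tendsto (fun ρ => (N ρ : ℝ) / ρ) atTop (𝓝 (Real.pi * a ^ 2)))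
    (hpos : 0 < farField L a) :
    ∀ᵐ ω ∂P, Tendsto (fun ρ => ρ / (N ρ : ℝ) * condSINR X T g f L σ N ρ ω) atTop
      (𝓝 (L 0 / farField L a)) := by
  have hball : ∀ᵐ ω ∂P, ∀ q : ℚ, 0 ≤ q →
      (∀ ρ, {i : ℕ | T i ω ≤ ρ ∧ ‖X i ω‖ ≤ q}.Finite) ∧
      Tendsto (fun ρ => ({i : ℕ | T i ω ≤ ρ ∧ ‖X i ω‖ ≤ q}.ncard : ℝ) / ρ) atTop
        (𝓝 (Real.pi * (q : ℝ) ^ 2)) := by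
    simp_rw [ae_all_iff]
    exact fun q hq => h.ae_tendsto_ncard_div (by exact_mod_cast hq)
  -- Restricting to rational radii leaves countably many exceptional null sets.
  have hfar := ae_all_iff.2 fun q : ℚ => h.ae_tendsto_tsum_div hL (q : ℝ)
  filter_upwards [h.ae_gain_nonneg, h.ae_tendsto_tsum_div hL 0, hball, hfar,
    h.ae_tendsto_sum_antenna_div] with ω hg h0 hb hf hfN
  have hdist0 : Tendsto (fun ρ => orderedDist X T ρ 0 ω) atTop (𝓝 0) :=
    tendsto_orderedDist hb (k := fun _ => 0) le_rfl (by simp)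
  have hserv : Tendsto (fun ρ => L (orderedDist X T ρ 0 ω)) atTop (𝓝 (L 0)) :=
    hL0.tendsto.comp (tendsto_nhdsWithin_iff.2
      ⟨hdist0, Eventually.of_forall fun ρ => orderedDist_nonneg X T ρ 0 ω⟩)
  have hres := tendsto_residual_div hL hg h0.1 (fun q => (hf q).2)
    (fun ρ => orderedDist_nonneg X T ρ (N ρ) ω) (tendsto_orderedDist hb ha hNa)
  have hnoise : Tendsto (fun ρ : ℝ => σ ^ 2 / ρ) atTop (𝓝 0) :=
    tendsto_const_nhds.div_atTop tendsto_id
  have hden := hres.add hnoise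
  rw [add_zero] at hden
  have hlim := (hserv.mul (hfN.comp hN)).div hden hpos.ne'
  rw [mul_one] at hlim
  -- The factor `1 / N ρ` normalises the antenna gains and `ρ` the interference plus noise. The
  -- identity holds at every `ρ`, since division by zero gives zero on both sides.
  refine hlim.congr fun ρ => ?_
  rw [condSINR, residualTerm_eq]
  simp only [Function.comp_apply, Pi.div_apply]
  rw [← add_div, div_div_eq_mul_div]
  ring

end IsDensifyingNetwork

/-! ### The two scaling regimes -/

theorem tendsto_log_one_add_div :
    Tendsto (fun x : ℝ => Real.log (1 + x) / x) (𝓝[≠] 0) (𝓝 1) := by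
  have h : HasDerivAt (fun x : ℝ => Real.log (1 + x)) 1 0 := by
    simpa using ((hasDerivAt_id (0 : ℝ)).const_add 1).log (by simp)
  have := hasDerivAt_iff_tendsto_slope.1 h
  refine this.congr fun x => ?_
  simp [slope_def_field]

theorem corollary3 {Ω : Type*} [MeasurableSpace Ω] (P : Measure Ω) [IsProbabilityMeasure P]
    (X : ℕ → Ω → Plane) (T : ℕ → Ω → ℝ) (g f : ℕ → Ω → ℝ)
    (hnet : IsDensifyingNetwork P X T g f)
    (L : ℝ → ℝ) (hL : PhysicallyFeasible L) (hL0 : ContinuousWithinAt L (Ici 0) 0)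
    (σ : ℝ) (N : ℝ → ℕ) (hmono : MonotoneOn N (Ioi 0)) (hN : Tendsto N atTop atTop) :
    (∀ᵐ ω ∂P, ∀ ρ : ℝ, 0 < ρ → Summable (residualTerm X T g L N ρ ω)) ∧
    (Tendsto (fun ρ : ℝ => ρ / (N ρ : ℝ)) atTop atTop →
      ∀ᵐ ω ∂P,
        Tendsto (fun ρ : ℝ => ρ / (N ρ : ℝ) * condSINR X T g f L σ N ρ ω) atTop
          (𝓝 (L 0 / (2 * Real.pi * pathLossGamma L))) ∧
        Tendsto (fun ρ : ℝ => condASE X T g f L σ N ρ ω) atTop atTop ∧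
        Tendsto (fun ρ : ℝ => condASE X T g f L σ N ρ ω / (N ρ : ℝ)) atTop
          (𝓝 (L 0 / (2 * Real.pi * pathLossGamma L * Real.log 2))) ∧
        Tendsto (fun ρ : ℝ => condASE X T g f L σ N ρ ω /
            (ρ * Real.logb 2 (1 + (N ρ : ℝ) / ρ))) atTop
          (𝓝 (L 0 / (2 * Real.pi * pathLossGamma L)))) ∧
    (∀ c : ℝ, L 0 / (2 * Real.pi * pathLossGamma L) < c →
      Tendsto (fun ρ : ℝ => ρ / (N ρ : ℝ)) atTop (𝓝 c) →
      ∃ l : ℝ, L 0 / (2 * Real.pi * c * pathLossGamma L) ≤ l ∧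
        l ≤ L 0 / (2 * Real.pi * c * pathLossGamma L - L 0) ∧
        ∀ᵐ ω ∂P,
          Tendsto (fun ρ : ℝ => condSINR X T g f L σ N ρ ω) atTop (𝓝 l) ∧
          Tendsto (fun ρ : ℝ => condASE X T g f L σ N ρ ω) atTop atTop ∧
          Tendsto (fun ρ : ℝ => condASE X T g f L σ N ρ ω / ρ) atTop
            (𝓝 (Real.logb 2 (1 + l))) ∧
          Tendsto (fun ρ : ℝ => condASE X T g f L σ N ρ ω /
              (ρ * Real.logb 2 (1 + (N ρ : ℝ) / ρ))) atTop
            (𝓝 (Real.logb 2 (1 + l) / Real.logb 2 (1 + 1 / c)))) := by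
  have hL0pos := hL.zero_pos
  have hγ := hL.gamma_pos
  have hpi := Real.pi_pos
  have hlog2 : 0 < Real.log 2 := Real.log_pos one_lt_two
  have hNreal : Tendsto (fun ρ => (N ρ : ℝ)) atTop atTop := tendsto_natCast_atTop_atTop.comp hN
  refine ⟨(hnet.ae_summable_residualTerm hL N).mono fun ω h ρ _ => h ρ, fun hratio => ?_,
    fun c hc hratio => ?_⟩
  · have hinv : Tendsto (fun ρ => (N ρ : ℝ) / ρ) atTop (𝓝 0) := by
      simpa [Function.comp_def] using tendsto_inv_atTop_zero.comp hratio
    have hfar : 0 < farField L 0 := by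
      rw [PhysicallyFeasible.farField_zero]; positivity
    have hmain := hnet.ae_tendsto_condSINR hL hL0 σ hN le_rfl (by simpa using hinv) hfar
    rw [PhysicallyFeasible.farField_zero] at hmain
    filter_upwards [hmain] with ω hω
    set K := L 0 / (2 * Real.pi * pathLossGamma L)
    have hK : 0 < K := by positivity
    set S := fun ρ => condSINR X T g f L σ N ρ ω
    have hNpos : ∀ᶠ ρ in atTop, (0 : ℝ) < N ρ := hNreal.eventually_gt_atTop 0
    -- The limit of `log (1 + x) / x` is along `x ≠ 0`, so the SINR must be eventually nonzero.
    have hSpos : ∀ᶠ ρ in atTop, 0 < S ρ := by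
      filter_upwards [hω.eventually (lt_mem_nhds hK), eventually_gt_atTop 0, hNpos] with ρ h1 h2 h3
      exact (mul_pos_iff_of_pos_left (by positivity)).1 h1
    have hS0 : Tendsto S atTop (𝓝 0) := by
      have := hinv.mul hω
      rw [zero_mul] at this
      refine this.congr' ?_
      filter_upwards [eventually_gt_atTop 0, hNpos] with ρ h1 h2
      simp only [S]
      field_simp
    have hlogS : Tendsto (fun ρ => Real.log (1 + S ρ) / S ρ) atTop (𝓝 1) :=
      tendsto_log_one_add_div.comp (tendsto_nhdsWithin_iff.2 ⟨hS0, hSpos.mono fun _ h => h.ne'⟩)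
    have hlogN : Tendsto (fun ρ => Real.log (1 + (N ρ : ℝ) / ρ) / ((N ρ : ℝ) / ρ)) atTop (𝓝 1) :=
      tendsto_log_one_add_div.comp (tendsto_nhdsWithin_iff.2 ⟨hinv, by
        filter_upwards [eventually_gt_atTop 0, hNpos] with ρ h1 h2
        exact (div_pos h2 h1).ne'⟩)
    have hASE : Tendsto (fun ρ => condASE X T g f L σ N ρ ω / (N ρ : ℝ)) atTop
        (𝓝 (L 0 / (2 * Real.pi * pathLossGamma L * Real.log 2))) := by
      have := (hω.mul hlogS).div_const (Real.log 2)
      rw [mul_one, div_div] at this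
      refine this.congr' ?_
      filter_upwards [hSpos, hNpos] with ρ h1 h2
      have h3 : condSINR X T g f L σ N ρ ω = S ρ := rfl
      rw [condASE, Real.logb, h3]
      field_simp
    refine ⟨hω, ?_, hASE, ?_⟩
    · refine (hNreal.atTop_mul_pos (by positivity) hASE).congr' ?_
      filter_upwards [hNpos] with ρ h
      field_simp
    · have := (hω.mul hlogS).div hlogN one_ne_zero
      rw [mul_one, div_one] at this
      refine this.congr' ?_
      filter_upwards [hSpos, hNpos, eventually_gt_atTop 0] with ρ h1 h2 h3
      have h4 : condSINR X T g f L σ N ρ ω = S ρ := rfl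
      have h5 : 0 < Real.log (1 + (N ρ : ℝ) / ρ) := Real.log_pos (by
        have : 0 < (N ρ : ℝ) / ρ := by positivity
        linarith)
      rw [condASE, Real.logb, Real.logb, h4]
      simp only [Pi.div_apply, h4]
      field_simp
  · have hc0 : 0 < c := lt_trans (by positivity) hc
    -- The limiting cancellation disc has area `1 / c`, the limit of `N ρ / ρ`.
    set a := √(1 / (Real.pi * c))
    have ha : Real.pi * a ^ 2 = 1 / c := by
      rw [Real.sq_sqrt (by positivity)]
      field_simp
    have hinv : Tendsto (fun ρ => (N ρ : ℝ) / ρ) atTop (𝓝 (1 / c)) := by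
      simpa [Function.comp_def] using hratio.inv₀ hc0.ne'
    have hbound := hL.farField_le_add le_rfl (Real.sqrt_nonneg (1 / (Real.pi * c)))
    have hle := hL.farField_antitone (Real.sqrt_nonneg (1 / (Real.pi * c)))
    rw [PhysicallyFeasible.farField_zero] at hbound hle
    rw [show (0 : ℝ) ^ 2 = 0 by norm_num, sub_zero, ha] at hbound
    have hgap : 0 < 2 * Real.pi * c * pathLossGamma L - L 0 := by
      rw [div_lt_iff₀ (by positivity)] at hc
      linarith
    -- Cancelling a disc of area `1 / c` removes at most `L 0 / c` from the total mean power `2πγ`.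
    -- The assumption on `c` says exactly that a positive amount is sure to remain.
    have hcJ : 2 * Real.pi * c * pathLossGamma L - L 0 ≤ c * farField L a := by
      have := mul_le_mul_of_nonneg_left hbound hc0.le
      have h2 : c * (farField L a + L 0 * (1 / c)) = c * farField L a + L 0 := by field_simp
      rw [h2] at this
      linarith
    have hJ : 0 < farField L a := (mul_pos_iff_of_pos_left hc0).1 (hgap.trans_le hcJ)
    have hmain := hnet.ae_tendsto_condSINR hL hL0 σ hN (Real.sqrt_nonneg _)
      (by rw [ha]; exact hinv) hJ
    have hcJle : c * farField L a ≤ 2 * Real.pi * c * pathLossGamma L := by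
      have := mul_le_mul_of_nonneg_left hle hc0.le
      linarith
    set l := L 0 / (c * farField L a)
    have hl : 0 < l := by positivity
    refine ⟨l, div_le_div_of_nonneg_left hL0pos.le (by positivity) hcJle,
      div_le_div_of_nonneg_left hL0pos.le hgap hcJ, ?_⟩
    filter_upwards [hmain] with ω hω
    have hS : Tendsto (fun ρ => condSINR X T g f L σ N ρ ω) atTop (𝓝 l) := by
      have := hinv.mul hω
      rw [show 1 / c * (L 0 / farField L a) = l by simp only [l]; field_simp] at this
      refine this.congr' ?_
      filter_upwards [eventually_gt_atTop 0, hNreal.eventually_gt_atTop 0] with ρ h1 h2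
      field_simp
    have hlogb : Tendsto (fun ρ => Real.logb 2 (1 + condSINR X T g f L σ N ρ ω)) atTop
        (𝓝 (Real.logb 2 (1 + l))) :=
      ((hS.const_add 1).log (by positivity)).div_const _
    have hlogbN : Tendsto (fun ρ => Real.logb 2 (1 + (N ρ : ℝ) / ρ)) atTop
        (𝓝 (Real.logb 2 (1 + 1 / c))) :=
      ((hinv.const_add 1).log (by positivity)).div_const _
    have hlpos : 0 < Real.logb 2 (1 + l) := Real.logb_pos one_lt_two (by linarith)
    have hcpos : 0 < Real.logb 2 (1 + 1 / c) := Real.logb_pos one_lt_two (by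
      have : 0 < 1 / c := by positivity
      linarith)
    refine ⟨hS, tendsto_id.atTop_mul_pos hlpos hlogb, hlogb.congr' ?_,
      (hlogb.div hlogbN hcpos.ne').congr' ?_⟩
    · filter_upwards [eventually_gt_atTop 0] with ρ h
      rw [condASE, mul_div_cancel_left₀ _ h.ne']
    · filter_upwards [eventually_gt_atTop 0] with ρ h
      rw [condASE, mul_div_mul_left _ _ h.ne']
      rfl
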